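/- **Theorem.** Let $\mathbb F$ be an algebraically closed field of characteristic $p>2$, let $m=2k\ge 2$ and $n=2l\ge 2$ be even integers, $s=m+n$, and let $\underline t=(t_1,\dots,t_m)$ be a tuple of positive integers. Let $H=H(m,n;\underline t)$ be the Hamiltonian Lie superalgebra over $\mathbb F$. Then $$\mathrm{BDer}(H)=\mathrm{IBDer}(H),$$ i.e. the skew-symmetric super-biderivations of $H$ are exactly the inner ones: for each of them there is $\lambda\in\mathbb F$ with $\phi(x,y)=\lambda[x,y]$ for all $x,y\in H$. *The algebra $H$.* Let $\Lambda(m,n)=\mathcal U(m)\otimes\Lambda(n)$ be the superalgebra with basis $x^{(\alpha)}x^u$, where $\alpha\in\mathbb N^m$ and $x^u=x_{i_1}\cdots x_{i_r}$ for $u=\{i_1<\dots<i_r\}\subseteq\{m+1,\dots,s\}$; here $x^{(\alpha)}x^{(\beta)}=\binom{\alpha+\beta}{\alpha}x^{(\alpha+\beta)}$, the $x^{(\alpha)}$ are even and central, and the $x_i$ with $i>m$ are odd and generate the Grassmann algebra $\Lambda(n)$. Let $\tau(i)=\bar 0$ for $i\le m$ and $\tau(i)=\bar 1$ for $i>m$,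 and let $D_i$ be the superderivation of parity $\tau(i)$ with $D_i(x^{(\alpha)}x^u)=x^{(\alpha-\varepsilon_i)}x^u$ for $i\le m$ (zero if $\alpha_i=0$) and $D_i(x^{(\alpha)}x^u)=x^{(\alpha)}\partial_i(x^u)$ for $i>m$, where $\partial_i$ is the left superderivation of $\Lambda(n)$ with $\partial_i(x_j)=\delta_{ij}$. Put $i'=i+k$ for $1\le i\le k$, $i'=i-k$ for $k<i\le 2k$, $i'=i+l$ for $2k<i\le 2k+l$, $i'=i-l$ for $2k+l<i\le s$; and $\sigma(i)=-1$ for $k<i\le 2k$, $\sigma(i)=1$ otherwise. For $f\in\Lambda(m,n)$ of parity $d(f)$ put $$D_H(f)=\sum_{i=1}^s\sigma(i')(-1)^{\tau(i')d(f)}D_{i'}(f)\,D_i,$$ extended linearly to all $f$. Let $\Lambda(m,n;\underline t)$ be the span of the $x^{(\alpha)}x^u$ with $0\le\alpha_i\le p^{t_i}-1$ for all $i$, and $\overline H=\{D_H(f): f\in\Lambda(m,n;\underline t)\}$. Then $H=[\overline H,\overline H]$, the span of all supercommutators of elements of $\overline H$; it is a Lie superalgebra under the supercommutator. *Super-biderivations.*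 For a Lie superalgebra $L$ over $\mathbb F$ and $\gamma\in\mathbb Z_2$, let $\mathrm{BDer}_\gamma(L)$ be the space of bilinear maps $\phi:L\times L\to L$ with $\phi(L_\alpha,L_\beta)\subseteq L_{\alpha+\beta+\gamma}$ for all $\alpha,\beta\in\mathbb Z_2$ such that, for all homogeneous $x,y$ of parities $d(x),d(y)$ and all $z\in L$, $$\phi(x,[y,z])=[\phi(x,y),z]+(-1)^{(\gamma+d(x))d(y)}[y,\phi(x,z)],$$ $$\phi(x,y)=-(-1)^{\gamma d(x)+\gamma d(y)+d(x)d(y)}\phi(y,x).$$ The elements of $\mathrm{BDer}(L)=\mathrm{BDer}_{\bar 0}(L)\oplus\mathrm{BDer}_{\bar 1}(L)$ are the skew-symmetric super-biderivations of $L$, and $\mathrm{IBDer}(L)=\{(x,y)\mapsto\lambda[x,y] : \lambda\in\mathbb F\}$. -/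

import Mathlib

/-! ## Signs -/

/-- The sign `(-1)^a` in `F` of a parity `a`. -/
def sgn (F : Type*) [Field F] (a : ZMod 2) : F := (-1) ^ a.val

theorem sgn_zero (F : Type*) [Field F] : sgn F 0 = 1 := by simp [sgn]

theorem sgn_one (F : Type*) [Field F] : sgn F 1 = -1 := by
  simp [sgn, ZMod.val_one]

theorem sgn_add (F : Type*) [Field F] (a b : ZMod 2) : sgn F (a + b) = sgn F a * sgn F b := by
  rcases (by decide +revert : a = 0 ∨ a = 1) with rfl | rfl <;>
  rcases (by decide +revert : b = 0 ∨ b = 1) with rfl | rfl <;>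
  simp [sgn_zero, sgn_one, (by decide : (1 : ZMod 2) + 1 = 0)]

theorem sgn_natCast (F : Type*) [Field F] (r : ℕ) : sgn F (r : ZMod 2) = (-1) ^ r := by
  induction r with
  | zero => simp [sgn_zero]
  | succ r ih => rw [Nat.cast_succ, sgn_add, ih, sgn_one, pow_succ]

/-! ## Lie superalgebras and skew-symmetric super-biderivations -/

/-- A Lie superalgebra over `F`: a superspace `L = part 0 ⊕ part 1` with an even bilinear bracket
that is super-skew-symmetric and satisfies the graded Jacobi identity. -/
class LieSuperalgebra (F L : Type*) [Field F] [AddCommGroup L] [Module F L] where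
  part : ZMod 2 → Submodule F L
  isCompl_part : IsCompl (part 0) (part 1)
  bracket : L →ₗ[F] L →ₗ[F] L
  bracket_mem : ∀ {a b : ZMod 2} {x y : L}, x ∈ part a → y ∈ part b →
    bracket x y ∈ part (a + b)
  skew : ∀ {a b : ZMod 2} {x y : L}, x ∈ part a → y ∈ part b →
    bracket x y = -(sgn F (a * b) • bracket y x)
  jacobi : ∀ {a b c : ZMod 2} {x y z : L}, x ∈ part a → y ∈ part b → z ∈ part c →
    bracket x (bracket y z) = bracket (bracket x y) z + sgn F (a * b) • bracket y (bracket x z)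

namespace LieSuperalgebra

variable (F L : Type*) [Field F] [AddCommGroup L] [Module F L] [LieSuperalgebra F L]

/-- The space of skew-symmetric super-biderivations of `L` that are homogeneous of degree `γ`. -/
def homBDer (γ : ZMod 2) : Submodule F (L →ₗ[F] L →ₗ[F] L) where
  carrier := {φ |
    (∀ (a b : ZMod 2) (x y : L), x ∈ part (F := F) a → y ∈ part (F := F) b → φ x y ∈ part (F := F) (a + b + γ)) ∧
    (∀ (a b : ZMod 2) (x y z : L), x ∈ part (F := F) a → y ∈ part (F := F) b →
      φ x (bracket (F := F) y z) =
        bracket (F := F) (φ x y) z + sgn F ((γ + a) * b) • bracket (F := F) y (φ x z)) ∧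
    (∀ (a b : ZMod 2) (x y : L), x ∈ part (F := F) a → y ∈ part (F := F) b →
      φ x y = -(sgn F (γ * a + γ * b + a * b) • φ y x))}
  zero_mem' := by simp
  add_mem' := by
    rintro φ ψ ⟨h1, h2, h3⟩ ⟨k1, k2, k3⟩
    refine ⟨fun a b x y hx hy => ?_, fun a b x y z hx hy => ?_, fun a b x y hx hy => ?_⟩
    · exact (part (F := F) (a + b + γ)).add_mem (h1 a b x y hx hy) (k1 a b x y hx hy)
    · rw [LinearMap.add_apply, LinearMap.add_apply, h2 a b x y z hx hy, k2 a b x y z hx hy]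
      simp only [LinearMap.add_apply, map_add, smul_add]
      abel
    · simp only [LinearMap.add_apply]
      rw [h3 a b x y hx hy, k3 a b x y hx hy, smul_add]
      abel
  smul_mem' := by
    rintro r φ ⟨h1, h2, h3⟩
    refine ⟨fun a b x y hx hy => ?_, fun a b x y z hx hy => ?_, fun a b x y hx hy => ?_⟩
    · exact (part (F := F) (a + b + γ)).smul_mem _ (h1 a b x y hx hy)
    · simp only [LinearMap.smul_apply, map_smul, h2 a b x y z hx hy, smul_add]
      rw [smul_comm r]
    · simp only [LinearMap.smul_apply]
      rw [h3 a b x y hx hy, smul_neg, smul_comm r]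

/-- `BDer(L)`, the sum of the spaces of even and of odd skew-symmetric super-biderivations. -/
def BDer : Submodule F (L →ₗ[F] L →ₗ[F] L) := homBDer F L 0 ⊔ homBDer F L 1

/-- `IBDer(L)`, the inner super-biderivations `(x, y) ↦ c [x, y]` with `c` in `F`. -/
def IBDer : Submodule F (L →ₗ[F] L →ₗ[F] L) where
  carrier := {φ | ∃ c : F, ∀ x y : L, φ x y = c • bracket (F := F) x y}
  zero_mem' := ⟨0, by simp⟩
  add_mem' := by
    rintro φ ψ ⟨c, hc⟩ ⟨d, hd⟩
    exact ⟨c + d, fun x y => by simp [hc, hd, add_smul]⟩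
  smul_mem' := by
    rintro r φ ⟨c, hc⟩
    exact ⟨r * c, fun x y => by simp [hc, mul_smul]⟩

end LieSuperalgebra

/-! ## The superalgebra `Λ(m,n)` -/

namespace Ham

/-- Index `(α, u)` of the basis element `x^(α) x^u` of `Λ(m,n)`. The odd variables
`x_{m+1}, …, x_{m+n}` are numbered by `Fin n`. -/
abbrev Mon (m n : ℕ) : Type := (Fin m → ℕ) × Finset (Fin n)

/-- The underlying space of `Λ(m,n) = U(m) ⊗ Λ(n)`, with basis the `x^(α) x^u`. -/
def Lam (F : Type*) [Field F] (m n : ℕ) : Type _ := Mon m n →₀ F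

noncomputable instance (F : Type*) [Field F] (m n : ℕ) : AddCommGroup (Lam F m n) :=
  inferInstanceAs (AddCommGroup (Mon m n →₀ F))

noncomputable instance (F : Type*) [Field F] (m n : ℕ) : Module F (Lam F m n) :=
  inferInstanceAs (Module F (Mon m n →₀ F))

/-- The linear map on `Λ(m,n)` with prescribed values on the basis elements `x^(α) x^u`. -/
noncomputable def lift (F : Type*) [Field F] {m n : ℕ} {M : Type*} [AddCommMonoid M] [Module F M]
    (v : Mon m n → M) : Lam F m n →ₗ[F] M :=
  Finsupp.linearCombination F v

section

variable (F : Type*) [Field F] {m n : ℕ}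

/-- The basis element `x^(α) x^u`. -/
noncomputable def e (a : Mon m n) : Lam F m n := Finsupp.single a 1

/-- The parity of `x^(α) x^u`. -/
def deg (a : Mon m n) : ZMod 2 := (a.2.card : ZMod 2)

/-- The number of transpositions needed to sort `x^u x^v`: pairs `i ∈ u`, `j ∈ v`, `j < i`. -/
def inv (u v : Finset (Fin n)) : ℕ := ((u ×ˢ v).filter fun q => q.2 < q.1).card

/-- The product `x^(α) x^u · x^(β) x^v` of two basis elements: it is
`± binom(α+β, α) x^(α+β) x^(u ∪ v)` if `u`, `v` are disjoint, and `0` otherwise. -/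
noncomputable def mulMon (a b : Mon m n) : Lam F m n :=
  if Disjoint a.2 b.2 then
    ((∏ i, ((a.1 i + b.1 i).choose (a.1 i) : F)) * (-1) ^ inv a.2 b.2) •
      e F (a.1 + b.1, a.2 ∪ b.2)
  else 0

/-- The product of `Λ(m,n)`. -/
noncomputable def mul : Lam F m n →ₗ[F] Lam F m n →ₗ[F] Lam F m n :=
  lift F fun a => lift F fun b => mulMon F a b

/-- The parity `τ(i)` of the `i`-th variable. -/
def tau : Fin m ⊕ Fin n → ZMod 2 := Sum.elim (fun _ => 0) (fun _ => 1)

/-- `D_i` on basis elements. For an even index, `x^(α) x^u ↦ x^(α - ε_i) x^u` (and `0` when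
`α_i = 0`); for an odd one, `x_i` is moved to the front of `x^u` and deleted. -/
noncomputable def DMon : Fin m ⊕ Fin n → Mon m n → Lam F m n
  | Sum.inl i, a => if a.1 i = 0 then 0 else e F (a.1 - Pi.single i 1, a.2)
  | Sum.inr j, a =>
      if j ∈ a.2 then (-1 : F) ^ (a.2.filter (· < j)).card • e F (a.1, a.2.erase j) else 0

/-- The superderivation `D_i` of `Λ(m,n)`. -/
noncomputable def D (i : Fin m ⊕ Fin n) : Module.End F (Lam F m n) :=
  lift F (DMon F i)

/-- The homogeneous part of `Λ(m,n)` of parity `b`. -/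
noncomputable def par (b : ZMod 2) : Submodule F (Lam F m n) :=
  Submodule.span F (e F '' {a : Mon m n | deg a = b})

/-- The projection of `Λ(m,n)` onto its part of parity `b`. -/
noncomputable def parProj (b : ZMod 2) : Module.End F (Lam F m n) :=
  lift F fun a => if deg a = b then e F a else 0

/-! ## The superalgebra of endomorphisms of `Λ(m,n)` -/

/-- The endomorphisms of `Λ(m,n)` of parity `a`. -/
noncomputable def endPar (a : ZMod 2) : Submodule F (Module.End F (Lam F m n)) where
  carrier := {T | ∀ b, ∀ f ∈ par F b, T f ∈ par F (a + b)}
  zero_mem' := by simp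
  add_mem' := fun h k b f hf => Submodule.add_mem _ (h b f hf) (k b f hf)
  smul_mem' := fun r _ h b f hf => Submodule.smul_mem _ r (h b f hf)

/-- The component of parity `a` of an endomorphism of `Λ(m,n)`. -/
noncomputable def endProj (a : ZMod 2) :
    Module.End F (Lam F m n) →ₗ[F] Module.End F (Lam F m n) :=
  ∑ b : ZMod 2, LinearMap.mulLeft F (parProj F (a + b)) ∘ₗ LinearMap.mulRight F (parProj F b)

/-- The supercommutator: the bilinear map on `End Λ(m,n)` with
`[S, T] = S T - (-1)^(ab) T S` for `S` of parity `a` and `T` of parity `b`. -/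
noncomputable def sbr : Module.End F (Lam F m n) →ₗ[F] Module.End F (Lam F m n) →ₗ[F]
    Module.End F (Lam F m n) :=
  ∑ a : ZMod 2, ∑ b : ZMod 2,
    ((LinearMap.mul F (Module.End F (Lam F m n))).compl₁₂ (endProj F a) (endProj F b) -
      sgn F (a * b) •
        (LinearMap.mul F (Module.End F (Lam F m n))).flip.compl₁₂ (endProj F a) (endProj F b))

end

/-! ## The Hamiltonian superalgebra, for `m = 2k` and `n = 2l` -/

/-- `i ↦ i'` inside a block of `2k` consecutive indices: `i + k` in the first half, `i - k` in the
second. -/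
def halfConj {k : ℕ} (i : Fin (2 * k)) : Fin (2 * k) :=
  if h : (i : ℕ) < k then ⟨i + k, by omega⟩ else ⟨i - k, by omega⟩

/-- The involution `i ↦ i'` of the index set. -/
def conj {k l : ℕ} : Fin (2 * k) ⊕ Fin (2 * l) → Fin (2 * k) ⊕ Fin (2 * l) :=
  Sum.map halfConj halfConj

section

variable (F : Type*) [Field F] {k l : ℕ}

/-- The signs `σ(i)`. -/
def sigma : Fin (2 * k) ⊕ Fin (2 * l) → F
  | Sum.inl i => if (i : ℕ) < k then 1 else -1
  | Sum.inr _ => 1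

/-- The map `D_H`, with values in `W(m,n) ⊆ End Λ(m,n)`: `D_H(f) = ∑ f_i D_i` where
`f_i = σ(i') (-1)^(τ(i') deg f) D_{i'}(f)` for homogeneous `f`. -/
noncomputable def DH : Lam F (2 * k) (2 * l) →ₗ[F] Module.End F (Lam F (2 * k) (2 * l)) :=
  lift F fun a => ∑ i,
    (sigma F (conj i) * sgn F (tau (conj i) * deg a)) • (mul F (D F (conj i) (e F a)) ∘ₗ D F i)

/-- The indices of the basis elements of `Λ(m,n;t)`: `α_i ≤ p^(t_i) - 1`. -/
def truncMon (p : ℕ) (l : ℕ) (t : Fin (2 * k) → ℕ) : Set (Mon (2 * k) (2 * l)) :=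
  {a | ∀ i, a.1 i < p ^ t i}

/-- The truncated subalgebra `Λ(m,n;t)`. -/
noncomputable def truncLam (p : ℕ) (l : ℕ) (t : Fin (2 * k) → ℕ) :
    Submodule F (Lam F (2 * k) (2 * l)) :=
  Submodule.span F (e F '' truncMon p l t)

/-- The space of all `D_H(f)` with `f` in `Λ(m,n;t)`. -/
noncomputable def HBar (p : ℕ) (l : ℕ) (t : Fin (2 * k) → ℕ) :
    Submodule F (Module.End F (Lam F (2 * k) (2 * l))) :=
  (truncLam F p l t).map (DH F)

/-- The Hamiltonian superalgebra `H(2k,2l;t)`: the span of all `[S, T]` with `S`, `T` in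
`HBar`. -/
noncomputable def H (p : ℕ) (l : ℕ) (t : Fin (2 * k) → ℕ) :
    Submodule F (Module.End F (Lam F (2 * k) (2 * l))) :=
  Submodule.map₂ (sbr F) (HBar F p l t) (HBar F p l t)

end

/-! ## Facts needed to see that `H` is a Lie superalgebra -/

section

variable {F : Type*} [Field F] {m n : ℕ}

theorem lc_e {M : Type*} [AddCommMonoid M] [Module F M] (v : Mon m n → M) (a : Mon m n) :
    lift F v (e F a) = v a :=
  (Finsupp.linearCombination_single F (1 : F) a).trans (one_smul _ _)

theorem mul_e_e (a b : Mon m n) : mul F (e F a) (e F b) = mulMon F a b := by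
  rw [mul, lc_e, lc_e]

theorem D_e (i : Fin m ⊕ Fin n) (a : Mon m n) : D F i (e F a) = DMon F i a := by
  simp [D, lc_e]

theorem span_e : Submodule.span F (Set.range (e F : Mon m n → Lam F m n)) = ⊤ := by
  have h : (e F : Mon m n → Lam F m n) = (Finsupp.basisSingleOne (R := F) (ι := Mon m n)) := by
    funext a
    exact (congrFun Finsupp.coe_basisSingleOne a).symm
  rw [h]
  exact Finsupp.basisSingleOne.span_eq

theorem lam_ext {M : Type*} [AddCommMonoid M] [Module F M] {f g : Lam F m n →ₗ[F] M}
    (h : ∀ a, f (e F a) = g (e F a)) : f = g :=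
  LinearMap.ext_on_range span_e h

theorem e_mem_par (a : Mon m n) : e F a ∈ par F (deg a) :=
  Submodule.subset_span ⟨a, rfl, rfl⟩

theorem e_mem_par' {a : Mon m n} {b : ZMod 2} (h : deg a = b) : e F a ∈ par F b :=
  h ▸ e_mem_par a

/-- Two linear maps that agree on the basis elements of parity `b` agree on the part `b`. -/
theorem par_ext {M : Type*} [AddCommMonoid M] [Module F M] {f g : Lam F m n →ₗ[F] M}
    {b : ZMod 2} (h : ∀ a, deg a = b → f (e F a) = g (e F a)) {x : Lam F m n}
    (hx : x ∈ par F b) : f x = g x := by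
  have : Set.EqOn f g (e F '' {a : Mon m n | deg a = b}) := by
    rintro _ ⟨a, ha, rfl⟩
    exact h a ha
  exact LinearMap.eqOn_span this hx

theorem par_map {f : Module.End F (Lam F m n)} {b c : ZMod 2}
    (h : ∀ a, deg a = b → f (e F a) ∈ par F c) {x : Lam F m n}
    (hx : x ∈ par F b) : f x ∈ par F c := by
  have : par F b ≤ (par F c).comap f := by
    refine Submodule.span_le.2 ?_
    rintro _ ⟨a, ha, rfl⟩
    exact h a ha
  exact this hx

/-! ### Parities -/

theorem tau_inl (i : Fin m) : tau (Sum.inl i : Fin m ⊕ Fin n) = 0 := rfl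

theorem tau_inr (i : Fin n) : tau (Sum.inr i : Fin m ⊕ Fin n) = 1 := rfl

theorem mulMon_mem (a b : Mon m n) : mulMon F a b ∈ par F (deg a + deg b) := by
  unfold mulMon
  split_ifs with h
  · refine Submodule.smul_mem _ _ (e_mem_par' ?_)
    simp [deg, Finset.card_union_of_disjoint h]
  · exact Submodule.zero_mem _

theorem mul_mem {a b : ZMod 2} {f g : Lam F m n} (hf : f ∈ par F a) (hg : g ∈ par F b) :
    mul F f g ∈ par F (a + b) := by
  refine par_map (f := mul F f) (fun y hy => ?_) hg
  refine par_map (f := (mul F).flip (e F y)) (fun x hx => ?_) hf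
  rw [LinearMap.flip_apply, mul_e_e, ← hx, ← hy]
  exact mulMon_mem x y

theorem DMon_mem (i : Fin m ⊕ Fin n) (a : Mon m n) : DMon F i a ∈ par F (tau i + deg a) := by
  rcases i with i | j
  · simp only [DMon]
    split_ifs
    · exact Submodule.zero_mem _
    · exact e_mem_par' (by simp [deg, tau])
  · simp only [DMon]
    split_ifs with h
    · refine Submodule.smul_mem _ _ (e_mem_par' ?_)
      have := Finset.card_erase_add_one h
      simp only [deg, tau, Sum.elim_inr]
      rw [← this]
      push_cast
      generalize ((a.2.erase j).card : ZMod 2) = x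
      decide +revert
    · exact Submodule.zero_mem _

theorem D_mem (i : Fin m ⊕ Fin n) {a : ZMod 2} {f : Lam F m n} (hf : f ∈ par F a) :
    D F i f ∈ par F (tau i + a) := by
  refine par_map (fun x hx => ?_) hf
  rw [D_e, ← hx]
  exact DMon_mem i x

/-! ### Signs of products of odd variables -/

theorem inv_union_left {u u' : Finset (Fin n)} (h : Disjoint u u') (v : Finset (Fin n)) :
    inv (u ∪ u') v = inv u v + inv u' v := by
  unfold inv
  rw [Finset.union_product, Finset.filter_union, Finset.card_union_of_disjoint]
  exact Finset.disjoint_filter_filter (Finset.disjoint_product.2 (Or.inl h))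

theorem inv_union_right {v v' : Finset (Fin n)} (h : Disjoint v v') (u : Finset (Fin n)) :
    inv u (v ∪ v') = inv u v + inv u v' := by
  unfold inv
  rw [Finset.product_union, Finset.filter_union, Finset.card_union_of_disjoint]
  exact Finset.disjoint_filter_filter (Finset.disjoint_product.2 (Or.inr h))

theorem inv_singleton_left (j : Fin n) (v : Finset (Fin n)) :
    inv {j} v = (v.filter (· < j)).card := by
  unfold inv
  rw [Finset.singleton_product, Finset.filter_map, Finset.card_map]
  rfl

theorem inv_singleton_right (j : Fin n) (u : Finset (Fin n)) :
    inv u {j} = (u.filter (j < ·)).card := by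
  unfold inv
  rw [Finset.product_singleton, Finset.filter_map, Finset.card_map]
  rfl

theorem inv_erase_left {u : Finset (Fin n)} {j : Fin n} (h : j ∈ u) (v : Finset (Fin n)) :
    inv u v = inv (u.erase j) v + (v.filter (· < j)).card := by
  rw [← inv_singleton_left, ← inv_union_left (by simp)]
  congr 1
  ext x
  by_cases hx : x = j <;> simp [hx, h]

theorem inv_erase_right {v : Finset (Fin n)} {j : Fin n} (h : j ∈ v) (u : Finset (Fin n)) :
    inv u v = inv u (v.erase j) + (u.filter (j < ·)).card := by
  rw [← inv_singleton_right, ← inv_union_right (by simp)]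
  congr 1
  ext x
  by_cases hx : x = j <;> simp [hx, h]

theorem inv_add_inv {u v : Finset (Fin n)} (h : Disjoint u v) :
    inv u v + inv v u = u.card * v.card := by
  have h1 : inv v u = ((u ×ˢ v).filter fun q => q.1 < q.2).card := by
    unfold inv
    refine Finset.card_bij (fun q _ => (q.2, q.1)) ?_ ?_ ?_
    · intro q hq
      simp only [Finset.mem_filter, Finset.mem_product] at hq ⊢
      tauto
    · rintro ⟨a, b⟩ _ ⟨c, d⟩ _ h
      simp_all
    · rintro ⟨a, b⟩ hq
      simp only [Finset.mem_filter, Finset.mem_product] at hq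
      exact ⟨(b, a), by simp only [Finset.mem_filter, Finset.mem_product]; tauto, rfl⟩
  rw [h1, inv, ← Finset.card_product, ← Finset.card_union_of_disjoint]
  · congr 1
    ext ⟨a, b⟩
    simp only [Finset.mem_union, Finset.mem_filter, Finset.mem_product]
    constructor
    · tauto
    · rintro ⟨ha, hb⟩
      have : a ≠ b := fun hab => Finset.disjoint_left.1 h ha (hab ▸ hb)
      rcases lt_or_gt_of_ne this with h | h <;> tauto
  · rw [Finset.disjoint_filter]
    intro q _ h1 h2
    exact absurd h1 (not_lt_of_gt h2)

theorem card_lt_add_card_gt (u : Finset (Fin n)) (j : Fin n) :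
    (u.filter (· < j)).card + (u.filter (j < ·)).card = (u.erase j).card := by
  rw [← Finset.card_union_of_disjoint]
  · congr 1
    ext x
    simp only [Finset.mem_union, Finset.mem_filter, Finset.mem_erase]
    constructor
    · rintro (⟨h, h'⟩ | ⟨h, h'⟩)
      · exact ⟨ne_of_lt h', h⟩
      · exact ⟨ne_of_gt h', h⟩
    · rintro ⟨h, h'⟩
      rcases lt_or_gt_of_ne h with h | h <;> tauto
  · rw [Finset.disjoint_filter]
    intro q _ h1 h2
    exact absurd h1 (not_lt_of_gt h2)

theorem filter_lt_erase (v : Finset (Fin n)) (j : Fin n) :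
    (v.erase j).filter (· < j) = v.filter (· < j) := by
  ext x
  simp only [Finset.mem_filter, Finset.mem_erase]
  constructor
  · tauto
  · rintro ⟨h, h'⟩
    exact ⟨⟨ne_of_lt h', h⟩, h'⟩

theorem filter_gt_erase (v : Finset (Fin n)) (j : Fin n) :
    (v.erase j).filter (j < ·) = v.filter (j < ·) := by
  ext x
  simp only [Finset.mem_filter, Finset.mem_erase]
  constructor
  · tauto
  · rintro ⟨h, h'⟩
    exact ⟨⟨ne_of_gt h', h⟩, h'⟩

/-! ### The product is associative and supercommutative -/

theorem mul_assoc_e (a b c : Mon m n) :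
    mul F (mul F (e F a) (e F b)) (e F c) = mul F (e F a) (mul F (e F b) (e F c)) := by
  rw [mul_e_e, mul_e_e]
  unfold mulMon
  by_cases hab : Disjoint a.2 b.2
  · by_cases hbc : Disjoint b.2 c.2
    · rw [if_pos hab, if_pos hbc, map_smul, map_smul, LinearMap.smul_apply, mul_e_e, mul_e_e]
      unfold mulMon
      by_cases hac : Disjoint a.2 c.2
      · have h1 : Disjoint (a.2 ∪ b.2) c.2 := Finset.disjoint_union_left.2 ⟨hac, hbc⟩
        have h2 : Disjoint a.2 (b.2 ∪ c.2) := Finset.disjoint_union_right.2 ⟨hab, hac⟩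
        rw [if_pos h1, if_pos h2, smul_smul, smul_smul, add_assoc, Finset.union_assoc]
        congr 1
        simp only [inv_union_left hab, inv_union_right hbc, pow_add]
        have hB : (∏ i, ((a.1 i + b.1 i).choose (a.1 i) : F)) *
            (∏ i, (((a.1 + b.1) i + c.1 i).choose ((a.1 + b.1) i) : F)) =
            (∏ i, ((b.1 i + c.1 i).choose (b.1 i) : F)) *
            (∏ i, ((a.1 i + (b.1 + c.1) i).choose (a.1 i) : F)) := by
          rw [← Finset.prod_mul_distrib, ← Finset.prod_mul_distrib]
          refine Finset.prod_congr rfl fun i _ => ?_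
          rw [← Nat.cast_mul, ← Nat.cast_mul]
          congr 1
          simp only [Pi.add_apply]
          have := Nat.choose_mul (n := a.1 i + b.1 i + c.1 i) (k := a.1 i + b.1 i) (s := a.1 i)
            (by omega)
          rw [show a.1 i + b.1 i + c.1 i - a.1 i = b.1 i + c.1 i by omega,
            show a.1 i + b.1 i - a.1 i = b.1 i by omega] at this
          rw [← add_assoc]
          linarith
        linear_combination
          ((-1) ^ inv a.2 b.2 * ((-1) ^ inv a.2 c.2 * (-1) ^ inv b.2 c.2) : F) * hB
      · rw [if_neg, if_neg, smul_zero, smul_zero]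
        · exact fun h => hac (Finset.disjoint_union_right.1 h).2
        · exact fun h => hac (Finset.disjoint_union_left.1 h).1
    · rw [if_pos hab, if_neg hbc, map_zero, map_smul, LinearMap.smul_apply, mul_e_e, mulMon,
        if_neg, smul_zero]
      exact fun h => hbc (Finset.disjoint_union_left.1 h).2
  · rw [if_neg hab, map_zero, LinearMap.zero_apply]
    split_ifs with hbc
    · rw [map_smul, mul_e_e, mulMon, if_neg, smul_zero]
      exact fun h => hab (Finset.disjoint_union_right.1 h).1
    · rw [map_zero]

theorem mul_assoc' (f g h : Lam F m n) :
    mul F (mul F f g) h = mul F f (mul F g h) := by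
  have : ∀ (a b : Mon m n), mul F (mul F (e F a) (e F b)) = mul F (e F a) ∘ₗ mul F (e F b) :=
    fun a b => lam_ext fun c => mul_assoc_e a b c
  have h2 : ∀ (a : Mon m n), (mul F).flip h ∘ₗ mul F (e F a) =
      mul F (e F a) ∘ₗ (mul F).flip h := fun a => lam_ext fun b => by
    simpa using LinearMap.congr_fun (this a b) h
  have h3 : (mul F).flip h ∘ₗ (mul F).flip g = (mul F).flip (mul F g h) := lam_ext fun a => by
    simpa using LinearMap.congr_fun (h2 a) g
  simpa using LinearMap.congr_fun h3 f

theorem neg_one_pow_add_self (r : ℕ) : ((-1) ^ r * (-1) ^ r : F) = 1 := by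
  rw [← mul_pow]; simp

theorem mul_comm_e (a b : Mon m n) :
    mul F (e F b) (e F a) = sgn F (deg a * deg b) • mul F (e F a) (e F b) := by
  rw [mul_e_e, mul_e_e]
  unfold mulMon
  by_cases h : Disjoint a.2 b.2
  · rw [if_pos h, if_pos h.symm, smul_smul, add_comm, Finset.union_comm]
    congr 1
    unfold deg
    rw [← Nat.cast_mul, sgn_natCast, ← inv_add_inv h, pow_add]
    have hB : (∏ i, ((b.1 i + a.1 i).choose (b.1 i) : F)) =
        (∏ i, ((a.1 i + b.1 i).choose (a.1 i) : F)) := by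
      refine Finset.prod_congr rfl fun i _ => ?_
      rw [add_comm, Nat.choose_symm_add]
    rw [hB]
    linear_combination (-(∏ i, ((a.1 i + b.1 i).choose (a.1 i) : F)) * (-1) ^ inv b.2 a.2) *
      neg_one_pow_add_self (F := F) (inv a.2 b.2)
  · rw [if_neg h, if_neg fun h' => h h'.symm, smul_zero]

theorem mul_comm' {a b : ZMod 2} {f g : Lam F m n} (hf : f ∈ par F a) (hg : g ∈ par F b) :
    mul F g f = sgn F (a * b) • mul F f g := by
  refine par_ext (f := (mul F).flip f) (g := sgn F (a * b) • mul F f) (fun y hy => ?_) hg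
  refine par_ext (f := mul F (e F y)) (g := sgn F (a * b) • (mul F).flip (e F y))
    (fun x hx => ?_) hf
  rw [mul_comm_e x y, hx, hy]
  rfl

/-! ### The `D_i` are superderivations and supercommute -/

theorem D_mul_e (i : Fin m ⊕ Fin n) (a b : Mon m n) :
    D F i (mul F (e F a) (e F b)) = mul F (D F i (e F a)) (e F b) +
      sgn F (tau i * deg a) • mul F (e F a) (D F i (e F b)) := by
  rw [D_e, D_e, mul_e_e]
  obtain ⟨α, u⟩ := a
  obtain ⟨β, v⟩ := b
  rcases i with i | j
  · rw [tau_inl, zero_mul, sgn_zero, one_smul]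
    simp only [DMon]
    by_cases h : Disjoint u v
    · have hE : ∀ γ : Fin m → ℕ, ∀ δ : Fin m → ℕ, mulMon F (γ, u) (δ, v) =
          (((γ i + δ i).choose (γ i) : F) * (∏ r ∈ Finset.univ.erase i,
            ((γ r + δ r).choose (γ r) : F)) * (-1) ^ inv u v) • e F (γ + δ, u ∪ v) := by
        intro γ δ
        simp only [mulMon]
        rw [if_pos h, Finset.mul_prod_erase Finset.univ
          (fun r => ((γ r + δ r).choose (γ r) : F)) (Finset.mem_univ i)]
      have hP1 : ∏ r ∈ Finset.univ.erase i,
          ((((α - Pi.single i 1 : Fin m → ℕ) r + β r).choose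
            ((α - Pi.single i 1 : Fin m → ℕ) r) : ℕ) : F) =
          ∏ r ∈ Finset.univ.erase i, ((α r + β r).choose (α r) : F) := by
        refine Finset.prod_congr rfl fun r hr => ?_
        have : r ≠ i := Finset.ne_of_mem_erase hr
        simp [this]
      have hP2 : ∏ r ∈ Finset.univ.erase i,
          (((α r + (β - Pi.single i 1 : Fin m → ℕ) r).choose (α r) : ℕ) : F) =
          ∏ r ∈ Finset.univ.erase i, ((α r + β r).choose (α r) : F) := by
        refine Finset.prod_congr rfl fun r hr => ?_
        have : r ≠ i := Finset.ne_of_mem_erase hr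
        simp [this]
      have hs1 : α i ≠ 0 → α - Pi.single i 1 + β = α + β - Pi.single i 1 := by
        intro h0
        ext r
        by_cases hr : r = i
        · subst hr; simp; omega
        · simp [hr]
      have hs2 : β i ≠ 0 → α + (β - Pi.single i 1) = α + β - Pi.single i 1 := by
        intro h0
        ext r
        by_cases hr : r = i
        · subst hr; simp; omega
        · simp [hr]
      rw [hE, map_smul, D_e]
      simp only [DMon, Pi.add_apply]
      by_cases hα : α i = 0
      · by_cases hβ : β i = 0
        · simp [hα, hβ]
        · rw [if_pos hα, if_neg hβ, if_neg (by omega), mul_e_e, hE, hP2, hs2 hβ]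
          simp [hα]
      · by_cases hβ : β i = 0
        · rw [if_neg hα, if_pos hβ, if_neg (by omega), mul_e_e, hE, hP1, hs1 hα]
          simp [hβ]
        · rw [if_neg hα, if_neg hβ, if_neg (by omega), mul_e_e, mul_e_e, hE, hE, hP1, hP2,
            hs1 hα, hs2 hβ, ← add_smul]
          congr 1
          have : (α i + β i).choose (α i) =
              ((α - Pi.single i 1 : Fin m → ℕ) i + β i).choose
                ((α - Pi.single i 1 : Fin m → ℕ) i) +
              (α i + (β - Pi.single i 1 : Fin m → ℕ) i).choose (α i) := by
            simp only [Pi.sub_apply, Pi.single_eq_same]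
            obtain ⟨x, hx⟩ := Nat.exists_eq_succ_of_ne_zero hα
            obtain ⟨y, hy⟩ := Nat.exists_eq_succ_of_ne_zero hβ
            rw [hx, hy]
            simp only [Nat.succ_eq_add_one, Nat.add_sub_cancel]
            rw [show x + 1 + (y + 1) = (x + 1 + y) + 1 by omega, Nat.choose_succ_succ,
              show x + (y + 1) = x + 1 + y by omega]
          rw [this, Nat.cast_add]
          ring
    · have h0 : ∀ γ δ : Fin m → ℕ, mulMon F (γ, u) (δ, v) = 0 := fun γ δ => if_neg h
      rw [h0, map_zero]
      split_ifs <;> simp [mul_e_e, h0]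
  · rw [tau_inr, one_mul, deg, sgn_natCast]
    simp only [DMon]
    have hB : ∀ w w' : Finset (Fin n), Disjoint w w' → mulMon F (α, w) (β, w') =
        ((∏ i, ((α i + β i).choose (α i) : F)) * (-1) ^ inv w w') • e F (α + β, w ∪ w') :=
      fun w w' h => if_pos h
    have h0 : ∀ w w' : Finset (Fin n), ¬ Disjoint w w' → mulMon F (α, w) (β, w') = 0 :=
      fun w w' h => if_neg h
    generalize (∏ i, ((α i + β i).choose (α i) : F)) = B at hB
    by_cases hu : j ∈ u
    · have hcu := Finset.card_erase_add_one hu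
      have hc := card_lt_add_card_gt u j
      by_cases hv : j ∈ v
      · rw [if_pos hu, if_pos hv, map_smul, map_smul, LinearMap.smul_apply, mul_e_e, mul_e_e,
          h0 u v (fun h => Finset.disjoint_left.1 h hu hv), map_zero]
        by_cases hd : Disjoint (u.erase j) (v.erase j)
        · have hd1 : Disjoint (u.erase j) v := by
            rw [Finset.disjoint_left] at hd ⊢
            intro x hx hx'
            exact hd hx (Finset.mem_erase.2 ⟨Finset.ne_of_mem_erase hx, hx'⟩)
          have hd2 : Disjoint u (v.erase j) := by
            rw [Finset.disjoint_left] at hd ⊢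
            intro x hx hx'
            exact hd (Finset.mem_erase.2 ⟨Finset.ne_of_mem_erase hx', hx⟩) hx'
          have e1 : u.erase j ∪ v = u ∪ v := by
            ext x; by_cases hx : x = j <;> simp [hx, hu, hv]
          have e2 : u ∪ v.erase j = u ∪ v := by
            ext x; by_cases hx : x = j <;> simp [hx, hu, hv]
          rw [hB _ _ hd1, hB _ _ hd2, e1, e2, inv_erase_right hv, inv_erase_left hu,
            filter_lt_erase, filter_gt_erase, smul_smul, smul_smul, smul_smul, ← add_smul]
          convert (zero_smul F (e F (α + β, u ∪ v))).symm using 2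
          rw [← hcu, ← hc]
          simp only [pow_add]
          linear_combination (-B * (-1) ^ (u.filter (· < j)).card *
            (-1) ^ inv (u.erase j) (v.erase j) * (-1) ^ (u.filter (j < ·)).card) *
            neg_one_pow_add_self (F := F) (v.filter (· < j)).card
        · rw [h0, h0]
          · simp
          · exact fun h => hd (h.mono_left (Finset.erase_subset _ _))
          · exact fun h => hd (h.mono_right (Finset.erase_subset _ _))
      · rw [if_pos hu, if_neg hv, map_zero, smul_zero, add_zero, map_smul, LinearMap.smul_apply,
          mul_e_e]
        by_cases hd : Disjoint u v
        · rw [hB _ _ hd, hB _ _ (hd.mono_left (Finset.erase_subset _ _)), map_smul, D_e]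
          simp only [DMon]
          rw [if_pos (Finset.mem_union_left _ hu), Finset.erase_union_distrib,
            Finset.erase_eq_of_notMem hv, smul_smul, smul_smul]
          congr 1
          rw [inv_erase_left hu, Finset.filter_union, Finset.card_union_of_disjoint
            (Finset.disjoint_filter_filter hd)]
          simp only [pow_add]
          linear_combination (B * (-1) ^ (u.filter (· < j)).card * (-1) ^ inv (u.erase j) v) *
            neg_one_pow_add_self (F := F) (v.filter (· < j)).card
        · rw [h0 _ _ hd, h0, map_zero, smul_zero]
          intro h
          refine hd (Finset.disjoint_left.2 fun x hx hx' => ?_)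
          have : x ≠ j := fun hxj => hv (hxj ▸ hx')
          exact Finset.disjoint_left.1 h (Finset.mem_erase.2 ⟨this, hx⟩) hx'
    · have hc := card_lt_add_card_gt u j
      rw [Finset.erase_eq_of_notMem hu] at hc
      by_cases hv : j ∈ v
      · rw [if_neg hu, if_pos hv, map_zero, LinearMap.zero_apply, zero_add, map_smul, mul_e_e]
        by_cases hd : Disjoint u v
        · rw [hB _ _ hd, hB _ _ (hd.mono_right (Finset.erase_subset _ _)), map_smul, D_e]
          simp only [DMon]
          rw [if_pos (Finset.mem_union_right _ hv), Finset.erase_union_distrib,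
            Finset.erase_eq_of_notMem hu, smul_smul, smul_smul, smul_smul]
          congr 1
          rw [inv_erase_right hv, Finset.filter_union, Finset.card_union_of_disjoint
            (Finset.disjoint_filter_filter hd), ← hc]
          simp only [pow_add]
          ring
        · rw [h0 _ _ hd, h0, map_zero, smul_zero, smul_zero]
          intro h
          refine hd (Finset.disjoint_left.2 fun x hx hx' => ?_)
          have : x ≠ j := fun hxj => hu (hxj ▸ hx)
          exact Finset.disjoint_left.1 h hx (Finset.mem_erase.2 ⟨this, hx'⟩)
      · rw [if_neg hu, if_neg hv, map_zero, map_zero, LinearMap.zero_apply, smul_zero, zero_add]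
        by_cases hd : Disjoint u v
        · rw [hB _ _ hd, map_smul, D_e]
          simp only [DMon]
          rw [if_neg (by simp [hu, hv]), smul_zero]
        · rw [h0 _ _ hd, map_zero]

theorem D_mul (i : Fin m ⊕ Fin n) {a : ZMod 2} {f : Lam F m n} (hf : f ∈ par F a)
    (g : Lam F m n) :
    D F i (mul F f g) = mul F (D F i f) g + sgn F (tau i * a) • mul F f (D F i g) := by
  have h1 : ∀ x : Mon m n, D F i ∘ₗ mul F (e F x) = mul F (D F i (e F x)) +
      sgn F (tau i * deg x) • (mul F (e F x) ∘ₗ D F i) := fun x => lam_ext fun y => by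
    simpa using D_mul_e i x y
  refine par_ext (f := D F i ∘ₗ (mul F).flip g)
    (g := (mul F).flip g ∘ₗ D F i + sgn F (tau i * a) • (mul F).flip (D F i g))
    (fun x hx => ?_) hf
  have := LinearMap.congr_fun (h1 x) g
  rw [hx] at this
  simpa using this

theorem D_comm_e (i j : Fin m ⊕ Fin n) (a : Mon m n) :
    D F i (D F j (e F a)) = sgn F (tau i * tau j) • D F j (D F i (e F a)) := by
  obtain ⟨α, u⟩ := a
  rw [D_e, D_e]
  rcases i with i | i <;> rcases j with j | j
  · rw [tau_inl, zero_mul, sgn_zero, one_smul]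
    simp only [DMon]
    by_cases hij : i = j
    · rw [hij]
    · split_ifs with h1 h2 h2 <;> simp [D_e, DMon, hij, Ne.symm hij, h1, h2]
      congr 2
      ext r
      simp only [Pi.sub_apply]
      omega
  · rw [tau_inl, zero_mul, sgn_zero, one_smul]
    simp only [DMon]
    split_ifs with h1 h2 h2 <;> simp [D_e, DMon, h1, h2]
  · rw [tau_inl, mul_zero, sgn_zero, one_smul]
    simp only [DMon]
    split_ifs with h1 h2 h2 <;> simp [D_e, DMon, h1, h2]
  · rw [tau_inr, tau_inr, mul_one, sgn_one]
    simp only [DMon]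
    by_cases hij : i = j
    · subst hij
      split_ifs <;> simp [D_e, DMon]
    · by_cases h1 : j ∈ u
      · by_cases h2 : i ∈ u
        · rw [if_pos h1, if_pos h2, map_smul, map_smul, D_e, D_e]
          simp only [DMon]
          rw [if_pos (Finset.mem_erase.2 ⟨hij, h2⟩), if_pos (Finset.mem_erase.2 ⟨Ne.symm hij, h1⟩),
            Finset.erase_right_comm, smul_smul, smul_smul, smul_smul]
          congr 1
          have hlt : ∀ {x y : Fin n}, x < y → x ∈ u →
              (u.filter (· < y)).card = ((u.erase x).filter (· < y)).card + 1 ∧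
              (u.erase y).filter (· < x) = u.filter (· < x) := by
            intro x y hxy hx
            constructor
            · rw [← Finset.card_erase_add_one (Finset.mem_filter.2 ⟨hx, hxy⟩),
                Finset.filter_erase]
            · rw [Finset.filter_erase, Finset.erase_eq_of_notMem]
              simp [not_lt_of_gt hxy]
          rcases lt_or_gt_of_ne hij with h | h
          · obtain ⟨ha, hb⟩ := hlt h h2
            rw [ha, hb, pow_succ]
            ring
          · obtain ⟨ha, hb⟩ := hlt h h1
            rw [ha, hb, pow_succ]
            ring
        · rw [if_pos h1, if_neg h2, map_zero, smul_zero, map_smul, D_e]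
          simp only [DMon]
          rw [if_neg (fun h => h2 (Finset.mem_of_mem_erase h)), smul_zero]
      · by_cases h2 : i ∈ u
        · rw [if_neg h1, if_pos h2, map_zero, map_smul, D_e]
          simp only [DMon]
          rw [if_neg (fun h => h1 (Finset.mem_of_mem_erase h)), smul_zero, smul_zero]
        · rw [if_neg h1, if_neg h2, map_zero, map_zero, smul_zero]

theorem D_comm (i j : Fin m ⊕ Fin n) (f : Lam F m n) :
    D F i (D F j f) = sgn F (tau i * tau j) • D F j (D F i f) := by
  have : D F i ∘ₗ D F j = sgn F (tau i * tau j) • (D F j ∘ₗ D F i) :=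
    lam_ext fun a => by simpa using D_comm_e i j a
  exact LinearMap.congr_fun this f

/-! ### Homogeneous components of elements and of endomorphisms -/

theorem zmod2_cases (a : ZMod 2) : a = 0 ∨ a = 1 := by decide +revert

theorem parProj_of_mem {c d : ZMod 2} {f : Lam F m n} (hf : f ∈ par F d) :
    parProj F c f = if d = c then f else 0 := by
  have := par_ext (f := parProj F c) (g := if d = c then LinearMap.id else 0) (fun x hx => by
    rw [parProj, lc_e, hx]
    split_ifs <;> rfl) hf
  rw [this]
  split_ifs <;> rfl

theorem parProj_mem (c : ZMod 2) (f : Lam F m n) : parProj F c f ∈ par F c := by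
  have : (⊤ : Submodule F (Lam F m n)) ≤ (par F c).comap (parProj F c) := by
    rw [← span_e, Submodule.span_le]
    rintro _ ⟨x, rfl⟩
    change parProj F c (e F x) ∈ par F c
    rw [parProj, lc_e]
    split_ifs with h
    · exact e_mem_par' h
    · exact Submodule.zero_mem _
  exact this (Submodule.mem_top (x := f))

theorem parProj_add (c : ZMod 2) (f : Lam F m n) :
    parProj F c f + parProj F (c + 1) f = f := by
  have : parProj F c + parProj F (c + 1) = (LinearMap.id : Module.End F (Lam F m n)) :=
    lam_ext fun x => by
      rw [LinearMap.add_apply, parProj_of_mem (e_mem_par x), parProj_of_mem (e_mem_par x)]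
      generalize deg x = d
      rcases zmod2_cases c with rfl | rfl <;> rcases zmod2_cases d with rfl | rfl <;>
        simp [(by decide : (1 : ZMod 2) + 1 = 0)]
  exact LinearMap.congr_fun this f

theorem par_disjoint {f : Lam F m n} {c d : ZMod 2} (h : c ≠ d) (hc : f ∈ par F c)
    (hd : f ∈ par F d) : f = 0 := by
  have h1 := parProj_of_mem (c := c) hc
  have h2 := parProj_of_mem (c := c) hd
  rw [if_pos rfl] at h1
  rw [if_neg (Ne.symm h)] at h2
  rw [← h1, h2]

theorem endProj_apply (a b : ZMod 2) (T : Module.End F (Lam F m n)) {f : Lam F m n}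
    (hf : f ∈ par F b) : endProj F a T f = parProj F (a + b) (T f) := by
  simp only [endProj, LinearMap.sum_apply, LinearMap.comp_apply, LinearMap.mulLeft_apply,
    LinearMap.mulRight_apply]
  rw [Finset.sum_eq_single b]
  · simp only [Module.End.mul_apply]
    rw [parProj_of_mem hf, if_pos rfl]
  · intro c _ hc
    simp only [Module.End.mul_apply]
    rw [parProj_of_mem hf, if_neg (Ne.symm hc), map_zero, map_zero]
  · simp

theorem endProj_mem (a : ZMod 2) (T : Module.End F (Lam F m n)) : endProj F a T ∈ endPar F a := by
  intro b f hf
  rw [endProj_apply a b T hf]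
  exact parProj_mem _ _

theorem endProj_add (T : Module.End F (Lam F m n)) : endProj F 0 T + endProj F 1 T = T := by
  refine lam_ext fun x => ?_
  rw [LinearMap.add_apply, endProj_apply _ _ _ (e_mem_par x), endProj_apply _ _ _ (e_mem_par x),
    zero_add, add_comm (1 : ZMod 2), parProj_add]

theorem endProj_of_mem {a c : ZMod 2} {T : Module.End F (Lam F m n)} (hT : T ∈ endPar F a) :
    endProj F c T = if c = a then T else 0 := by
  refine lam_ext fun x => ?_
  rw [endProj_apply _ _ _ (e_mem_par x), parProj_of_mem (hT _ _ (e_mem_par x))]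
  by_cases h : c = a
  · rw [if_pos h, h, if_pos rfl]
  · rw [if_neg h, if_neg (fun h' => h (add_right_cancel h').symm), LinearMap.zero_apply]

theorem end_disjoint {T : Module.End F (Lam F m n)} (h0 : T ∈ endPar F 0) (h1 : T ∈ endPar F 1) :
    T = 0 := by
  refine lam_ext fun x => ?_
  refine par_disjoint (c := 0 + deg x) (d := 1 + deg x) ?_ (h0 _ _ (e_mem_par x))
    (h1 _ _ (e_mem_par x))
  intro h
  exact absurd (add_right_cancel h) (by decide)

/-! ### The supercommutator makes the endomorphisms a Lie superalgebra -/

theorem sbr_apply {a b : ZMod 2} {S T : Module.End F (Lam F m n)} (hS : S ∈ endPar F a)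
    (hT : T ∈ endPar F b) : sbr F S T = S * T - sgn F (a * b) • (T * S) := by
  simp only [sbr, LinearMap.sum_apply, LinearMap.sub_apply, LinearMap.smul_apply,
    LinearMap.compl₁₂_apply, LinearMap.mul_apply', LinearMap.flip_apply]
  rw [Finset.sum_eq_single a, Finset.sum_eq_single b]
  · rw [endProj_of_mem hS, endProj_of_mem hT, if_pos rfl, if_pos rfl]
  · intro c _ hc
    rw [endProj_of_mem hT, if_neg hc, mul_zero, zero_mul, smul_zero, sub_zero]
  · simp
  · intro c _ hc
    refine Finset.sum_eq_zero fun d _ => ?_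
    rw [endProj_of_mem hS, if_neg hc, mul_zero, zero_mul, smul_zero, sub_zero]
  · simp

theorem end_mul_mem {a b : ZMod 2} {S T : Module.End F (Lam F m n)} (hS : S ∈ endPar F a)
    (hT : T ∈ endPar F b) : S * T ∈ endPar F (a + b) := by
  intro c f hf
  rw [add_assoc]
  exact hS _ _ (hT _ _ hf)

theorem sbr_mem {a b : ZMod 2} {S T : Module.End F (Lam F m n)} (hS : S ∈ endPar F a)
    (hT : T ∈ endPar F b) : sbr F S T ∈ endPar F (a + b) := by
  rw [sbr_apply hS hT]
  refine (endPar F (a + b)).sub_mem (end_mul_mem hS hT) ((endPar F (a + b)).smul_mem _ ?_)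
  rw [add_comm]
  exact end_mul_mem hT hS

theorem sgn_mul_self (a : ZMod 2) : sgn F a * sgn F a = 1 := by
  rw [← sgn_add, CharTwo.add_self_eq_zero, sgn_zero]

theorem alg_skew {A : Type*} [Ring A] [Algebra F A] (S T : A) {x : F} (h : x * x = 1) :
    S * T - x • (T * S) = -(x • (T * S - x • (S * T))) := by
  rw [smul_sub, smul_smul, h, one_smul]
  abel

theorem alg_jacobi {A : Type*} [Ring A] [Algebra F A] (S T U : A) {x y z : F} (h : x * x = 1) :
    S * (T * U - y • (U * T)) - (x * z) • ((T * U - y • (U * T)) * S) =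
      (S * T - x • (T * S)) * U - (z * y) • (U * (S * T - x • (T * S))) +
      x • (T * (S * U - z • (U * S)) - (x * y) • ((S * U - z • (U * S)) * T)) := by
  simp only [mul_sub, sub_mul, smul_sub, smul_mul_assoc, mul_smul_comm, smul_smul, mul_assoc]
  match_scalars
  all_goals first
    | ring1
    | linear_combination y * h
    | linear_combination (-y) * h
    | linear_combination (z * y) * h
    | linear_combination (-(z * y)) * h

theorem sbr_skew {a b : ZMod 2} {S T : Module.End F (Lam F m n)} (hS : S ∈ endPar F a)
    (hT : T ∈ endPar F b) : sbr F S T = -(sgn F (a * b) • sbr F T S) := by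
  rw [sbr_apply hS hT, sbr_apply hT hS, mul_comm b a]
  exact alg_skew S T (sgn_mul_self _)

theorem sbr_jacobi {a b c : ZMod 2} {S T U : Module.End F (Lam F m n)} (hS : S ∈ endPar F a)
    (hT : T ∈ endPar F b) (hU : U ∈ endPar F c) :
    sbr F S (sbr F T U) = sbr F (sbr F S T) U + sgn F (a * b) • sbr F T (sbr F S U) := by
  rw [sbr_apply hS (sbr_mem hT hU), sbr_apply (sbr_mem hS hT) hU, sbr_apply hT (sbr_mem hS hU),
    sbr_apply hS hT, sbr_apply hS hU, sbr_apply hT hU, add_mul, mul_add, mul_add, mul_comm b a,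
    sgn_add, sgn_add, sgn_add]
  exact alg_jacobi S T U (sgn_mul_self _)

end

section

variable {F : Type*} [Field F] {k l : ℕ}

/-! ### The identity `[D_H(f), D_H(g)] = D_H(D_H(f)(g))` -/

theorem halfConj_halfConj (i : Fin (2 * k)) : halfConj (halfConj i) = i := by
  unfold halfConj
  ext
  by_cases h : (i : ℕ) < k
  · simp [h]
  · have h2 : (i : ℕ) - k < k := by omega
    simp only [h, dite_false, h2, dite_true]
    omega

theorem conj_conj (i : Fin (2 * k) ⊕ Fin (2 * l)) : conj (conj i) = i := by
  rcases i with i | i <;> simp [conj, halfConj_halfConj]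

theorem tau_conj (i : Fin (2 * k) ⊕ Fin (2 * l)) : tau (conj i) = tau i := by
  rcases i with i | i <;> simp [conj, tau]

theorem sigma_conj (i : Fin (2 * k) ⊕ Fin (2 * l)) :
    sigma F (conj i) = -(sgn F (tau i) * sigma F i) := by
  rcases i with i | i
  · simp only [conj, Sum.map_inl, sigma, tau_inl, sgn_zero, one_mul, halfConj]
    by_cases h : (i : ℕ) < k
    · simp [h]
    · have h2 : (i : ℕ) - k < k := by omega
      simp [h, h2]
  · simp [conj, sigma, tau_inr, sgn_one]

/-- The coefficient of `D_{i'}(f) D_i` in `D_H(f)` for `f` of parity `a`. -/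
def cf (F : Type*) [Field F] (a : ZMod 2) (i : Fin (2 * k) ⊕ Fin (2 * l)) : F :=
  sigma F (conj i) * sgn F (tau i * a)

theorem DH_apply {a : ZMod 2} {f : Lam F (2 * k) (2 * l)} (hf : f ∈ par F a)
    (h : Lam F (2 * k) (2 * l)) :
    DH F f h = ∑ i, cf F a i • mul F (D F (conj i) f) (D F i h) := by
  have := par_ext (f := (DH F).flip h)
    (g := ∑ i, cf F a i • ((mul F).flip (D F i h) ∘ₗ D F (conj i))) (fun x hx => by
      rw [LinearMap.flip_apply, DH, lc_e, LinearMap.sum_apply, LinearMap.sum_apply]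
      refine Finset.sum_congr rfl fun i _ => ?_
      rw [hx, tau_conj]
      rfl) hf
  rw [LinearMap.flip_apply] at this
  rw [this, LinearMap.sum_apply]
  rfl

theorem D_conj_mem (i : Fin (2 * k) ⊕ Fin (2 * l)) {a : ZMod 2} {f : Lam F (2 * k) (2 * l)}
    (hf : f ∈ par F a) : D F (conj i) f ∈ par F (tau i + a) := by
  have := D_mem (conj i) hf
  rwa [tau_conj] at this

theorem DH_mem {a : ZMod 2} {f : Lam F (2 * k) (2 * l)} (hf : f ∈ par F a) :
    DH F f ∈ endPar F a := by
  intro b g hg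
  rw [DH_apply hf]
  refine Submodule.sum_mem _ fun i _ => Submodule.smul_mem _ _ ?_
  have := mul_mem (D_conj_mem i hf) (D_mem i hg)
  convert this using 2
  generalize tau i = x
  clear * -
  decide +revert

/-- `D_H(f)` is a superderivation. -/
theorem DH_mul {a b : ZMod 2} {f g : Lam F (2 * k) (2 * l)} (hf : f ∈ par F a) (hg : g ∈ par F b)
    (h : Lam F (2 * k) (2 * l)) :
    DH F f (mul F g h) = mul F (DH F f g) h + sgn F (a * b) • mul F g (DH F f h) := by
  rw [DH_apply hf, DH_apply hf, DH_apply hf, map_sum, map_sum, LinearMap.sum_apply,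
    Finset.smul_sum, ← Finset.sum_add_distrib]
  refine Finset.sum_congr rfl fun i _ => ?_
  rw [D_mul i hg, map_add, map_smul, map_smul, map_smul, LinearMap.smul_apply, ← mul_assoc',
    ← mul_assoc', ← mul_assoc', mul_comm' (D_conj_mem i hf) hg, map_smul, LinearMap.smul_apply]
  have : sgn F (a * b) * sgn F ((tau i + a) * b) = sgn F (tau i * b) := by
    rw [← sgn_add]
    congr 1
    generalize tau i = x
    clear * -
    decide +revert
  rw [← this]
  module

theorem DH_swap {a b : ZMod 2} {f g : Lam F (2 * k) (2 * l)} (hf : f ∈ par F a)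
    (hg : g ∈ par F b) (j : Fin (2 * k) ⊕ Fin (2 * l)) :
    D F (conj j) (DH F f g) =
      sgn F (tau j * a) • DH F f (D F (conj j) g) -
      (sgn F (tau j * (a + b)) * sgn F (a * b) * sgn F (tau j * a)) •
        DH F g (D F (conj j) f) := by
  rw [DH_apply hf, DH_apply hf, DH_apply hg, map_sum, Finset.smul_sum, sub_eq_add_neg, ← neg_smul,
    Finset.smul_sum]
  have hre : ∑ i, (-(sgn F (tau j * (a + b)) * sgn F (a * b) * sgn F (tau j * a))) •
      cf F b i • mul F (D F (conj i) g) (D F i (D F (conj j) f)) =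
      ∑ i, (-(sgn F (tau j * (a + b)) * sgn F (a * b) * sgn F (tau j * a))) •
      cf F b (conj i) • mul F (D F i g) (D F (conj i) (D F (conj j) f)) := by
    refine Finset.sum_bij (fun i _ => conj i) (fun _ _ => Finset.mem_univ _) ?_ ?_ ?_
    · intro x _ y _ hxy
      rw [← conj_conj x, hxy, conj_conj]
    · intro y _
      exact ⟨conj y, Finset.mem_univ _, conj_conj y⟩
    · intro x _
      rw [conj_conj]
  rw [hre, ← Finset.sum_add_distrib]
  refine Finset.sum_congr rfl fun i _ => ?_
  rw [map_smul, D_mul (conj j) (D_conj_mem i hf), D_comm (conj j) i g,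
    mul_comm' (D_conj_mem i (D_conj_mem j hf)) (D_mem i hg), D_comm (conj i) (conj j) f]
  simp only [tau_conj, map_smul, LinearMap.smul_apply, smul_add, smul_smul]
  rw [add_comm]
  congr 2
  · have : sgn F (tau j * a) = sgn F (tau j * (tau i + a)) * sgn F (tau j * tau i) := by
      rw [← sgn_add]
      congr 1
      generalize tau i = x
      generalize tau j = y
      clear * -
      decide +revert
    rw [this]
    ring
  · simp only [cf, tau_conj, conj_conj]
    rw [sigma_conj]
    have : sgn F (tau i) * sgn F (tau i * a) = sgn F (tau j * (a + b)) * sgn F (a * b) *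
        sgn F (tau j * a) * sgn F (tau i * b) * sgn F ((tau i + (tau j + a)) * (tau i + b)) *
        sgn F (tau i * tau j) := by
      simp only [← sgn_add]
      congr 1
      generalize tau i = x
      generalize tau j = y
      clear * -
      decide +revert
    linear_combination (-sigma F i) * this

theorem DH_bracket {a b : ZMod 2} {f g : Lam F (2 * k) (2 * l)} (hf : f ∈ par F a)
    (hg : g ∈ par F b) : sbr F (DH F f) (DH F g) = DH F (DH F f g) := by
  rw [sbr_apply (DH_mem hf) (DH_mem hg)]
  refine LinearMap.ext fun h => ?_
  rw [LinearMap.sub_apply, LinearMap.smul_apply, Module.End.mul_apply, Module.End.mul_apply,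
    DH_apply (DH_mem hf b g hg) h]
  have h1 : DH F f (DH F g h) = ∑ j, cf F b j • (mul F (DH F f (D F (conj j) g)) (D F j h) +
      sgn F (a * (tau j + b)) • ∑ i, cf F a i •
        mul F (D F (conj j) g) (mul F (D F (conj i) f) (D F i (D F j h)))) := by
    rw [DH_apply hg h, map_sum]
    refine Finset.sum_congr rfl fun j _ => ?_
    rw [map_smul, DH_mul hf (D_conj_mem j hg), DH_apply hf (D F j h), map_sum]
    simp only [map_smul]
  have h2 : DH F g (DH F f h) = ∑ j, cf F a j • (mul F (DH F g (D F (conj j) f)) (D F j h) +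
      sgn F (b * (tau j + a)) • ∑ i, cf F b i •
        mul F (D F (conj j) f) (mul F (D F (conj i) g) (D F i (D F j h)))) := by
    rw [DH_apply hf h, map_sum]
    refine Finset.sum_congr rfl fun j _ => ?_
    rw [map_smul, DH_mul hg (D_conj_mem j hf), DH_apply hg (D F j h), map_sum]
    simp only [map_smul]
  have h3 : ∑ j, cf F b j • sgn F (a * (tau j + b)) • ∑ i, cf F a i •
        mul F (D F (conj j) g) (mul F (D F (conj i) f) (D F i (D F j h))) =
      sgn F (a * b) • ∑ j, cf F a j • sgn F (b * (tau j + a)) • ∑ i, cf F b i •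
        mul F (D F (conj j) f) (mul F (D F (conj i) g) (D F i (D F j h))) := by
    simp only [Finset.smul_sum]
    rw [Finset.sum_comm]
    refine Finset.sum_congr rfl fun i _ => Finset.sum_congr rfl fun j _ => ?_
    rw [← mul_assoc', ← mul_assoc', mul_comm' (D_conj_mem i hf) (D_conj_mem j hg), D_comm i j]
    simp only [map_smul, LinearMap.smul_apply, smul_smul]
    congr 1
    have : sgn F (a * (tau j + b)) * sgn F ((tau i + a) * (tau j + b)) * sgn F (tau i * tau j) =
        sgn F (a * b) * sgn F (b * (tau i + a)) := by
      simp only [← sgn_add]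
      congr 1
      generalize tau i = x
      generalize tau j = y
      clear * -
      decide +revert
    linear_combination (cf F b j * cf F a i) * this
  rw [h1, h2]
  simp only [smul_add, Finset.sum_add_distrib]
  rw [h3, add_sub_add_right_eq_sub, Finset.smul_sum, ← Finset.sum_sub_distrib]
  refine Finset.sum_congr rfl fun j _ => ?_
  rw [DH_swap hf hg j, map_sub, map_smul, map_smul, LinearMap.sub_apply, LinearMap.smul_apply,
    LinearMap.smul_apply, smul_sub, smul_smul, smul_smul, smul_smul]
  congr 2
  · simp only [cf, mul_assoc]
    rw [← sgn_add]
    congr 2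
    generalize tau j = y
    clear * -
    decide +revert
  · simp only [cf]
    have : sgn F (a * b) * sgn F (tau j * a) = sgn F (tau j * (a + b)) *
        (sgn F (tau j * (a + b)) * sgn F (a * b) * sgn F (tau j * a)) := by
      simp only [← sgn_add]
      congr 1
      generalize tau j = y
      clear * -
      decide +revert
    linear_combination (sigma F (conj j)) * this

/-! ### Truncation -/

theorem choose_eq_zero {p : ℕ} [Fact p.Prime] [CharP F p] {r x y : ℕ} (hx : x < p ^ r)
    (hy : y < p ^ r) (hxy : p ^ r ≤ x + y) : ((x + y).choose x : F) = 0 := by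
  rw [CharP.cast_eq_zero_iff F p]
  have hp : p.Prime := Fact.out
  have hr : r ≠ 0 := by
    rintro rfl
    rw [pow_zero] at hx hy hxy
    omega
  refine dvd_of_one_le_padicValNat ?_
  rw [add_comm x y, padicValNat_choose' (Nat.lt_add_one _)]
  refine Finset.card_pos.2 ⟨r, Finset.mem_filter.2 ⟨Finset.mem_Ico.2 ⟨Nat.one_le_iff_ne_zero.2 hr, ?_⟩, ?_⟩⟩
  · exact Nat.lt_succ_of_le (Nat.le_log_of_pow_le hp.one_lt (hxy.trans_eq (add_comm _ _)))
  · rw [Nat.mod_eq_of_lt hx, Nat.mod_eq_of_lt hy]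
    exact hxy

theorem mul_mem_trunc {p : ℕ} [Fact p.Prime] [CharP F p] {t : Fin (2 * k) → ℕ}
    {f g : Lam F (2 * k) (2 * l)} (hf : f ∈ truncLam F p l t) (hg : g ∈ truncLam F p l t) :
    mul F f g ∈ truncLam F p l t := by
  have key : Submodule.map₂ (mul F) (truncLam F p l t) (truncLam F p l t) ≤ truncLam F p l t := by
    conv_lhs => rw [truncLam, Submodule.map₂_span_span]
    refine Submodule.span_le.2 ?_
    rintro _ ⟨_, ⟨a, ha, rfl⟩, _, ⟨b, hb, rfl⟩, rfl⟩
    change mul F (e F a) (e F b) ∈ truncLam F p l t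
    rw [mul_e_e, mulMon]
    split_ifs with h
    · by_cases hab : a.1 + b.1 ∈ {α : Fin (2 * k) → ℕ | ∀ i, α i < p ^ t i}
      · exact Submodule.smul_mem _ _ (Submodule.subset_span ⟨_, hab, rfl⟩)
      · simp only [Set.mem_ofPred_eq, not_forall, not_lt] at hab
        obtain ⟨i, hi⟩ := hab
        rw [Finset.prod_eq_zero (Finset.mem_univ i) (choose_eq_zero (p := p) (ha i) (hb i) hi),
          zero_mul, zero_smul]
        exact Submodule.zero_mem _
    · exact Submodule.zero_mem _
  exact key (Submodule.apply_mem_map₂ _ hf hg)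

theorem D_mem_trunc {p : ℕ} {t : Fin (2 * k) → ℕ} (i : Fin (2 * k) ⊕ Fin (2 * l))
    {f : Lam F (2 * k) (2 * l)} (hf : f ∈ truncLam F p l t) :
    D F i f ∈ truncLam F p l t := by
  have key : truncLam F p l t ≤ (truncLam F p l t).comap (D F i) := by
    refine Submodule.span_le.2 ?_
    rintro _ ⟨a, ha, rfl⟩
    change D F i (e F a) ∈ truncLam F p l t
    rw [D_e]
    rcases i with i | j
    · simp only [DMon]
      split_ifs
      · exact Submodule.zero_mem _
      · exact Submodule.subset_span ⟨_, fun r => lt_of_le_of_lt (Nat.sub_le _ _) (ha r), rfl⟩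
    · simp only [DMon]
      split_ifs
      · exact Submodule.smul_mem _ _ (Submodule.subset_span ⟨(a.1, a.2.erase j), ha, rfl⟩)
      · exact Submodule.zero_mem _
  exact key hf

theorem HBar_eq (p : ℕ) (l : ℕ) (t : Fin (2 * k) → ℕ) :
    HBar F p l t = Submodule.span F ((fun a => DH F (e F a)) '' truncMon p l t) := by
  rw [HBar, truncLam, Submodule.map_span, Set.image_image]

theorem H_eq (p : ℕ) (l : ℕ) (t : Fin (2 * k) → ℕ) :
    H F p l t = Submodule.span F (Set.image2 (fun S T => sbr F S T)
      ((fun a => DH F (e F a)) '' truncMon p l t) ((fun a => DH F (e F a)) '' truncMon p l t)) := by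
  rw [H, HBar_eq, Submodule.map₂_span_span]

theorem H_le (p : ℕ) [Fact p.Prime] [CharP F p] (l : ℕ) (t : Fin (2 * k) → ℕ) :
    H F p l t ≤ HBar F p l t := by
  rw [H_eq]
  refine Submodule.span_le.2 ?_
  rintro _ ⟨_, ⟨a, ha, rfl⟩, _, ⟨b, hb, rfl⟩, rfl⟩
  change sbr F (DH F (e F a)) (DH F (e F b)) ∈ HBar F p l t
  have ha' : e F a ∈ truncLam F p l t := Submodule.subset_span ⟨a, ha, rfl⟩
  have hb' : e F b ∈ truncLam F p l t := Submodule.subset_span ⟨b, hb, rfl⟩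
  rw [DH_bracket (e_mem_par a) (e_mem_par b)]
  refine Submodule.mem_map_of_mem ?_
  rw [DH_apply (e_mem_par a)]
  exact Submodule.sum_mem _ fun i _ => Submodule.smul_mem _ _
    (mul_mem_trunc (D_mem_trunc _ ha') (D_mem_trunc _ hb'))

theorem sbr_mem_H (p : ℕ) [Fact p.Prime] [CharP F p] {l : ℕ} {t : Fin (2 * k) → ℕ}
    {S T : Module.End F (Lam F (2 * k) (2 * l))} (hS : S ∈ H F p l t) (hT : T ∈ H F p l t) :
    sbr F S T ∈ H F p l t :=
  Submodule.apply_mem_map₂ _ (H_le p l t hS) (H_le p l t hT)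

theorem endProj_mem_H {p : ℕ} {l : ℕ} {t : Fin (2 * k) → ℕ} (c : ZMod 2)
    {S : Module.End F (Lam F (2 * k) (2 * l))} (hS : S ∈ H F p l t) :
    endProj F c S ∈ H F p l t := by
  have key : H F p l t ≤ (H F p l t).comap (endProj F c) := by
    conv_lhs => rw [H_eq]
    refine Submodule.span_le.2 ?_
    rintro _ ⟨_, ⟨a, ha, rfl⟩, _, ⟨b, hb, rfl⟩, rfl⟩
    change endProj F c (sbr F (DH F (e F a)) (DH F (e F b))) ∈ H F p l t
    rw [endProj_of_mem (sbr_mem (DH_mem (e_mem_par a)) (DH_mem (e_mem_par b)))]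
    split_ifs
    · rw [H_eq]
      exact Submodule.subset_span ⟨_, ⟨a, ha, rfl⟩, _, ⟨b, hb, rfl⟩, rfl⟩
    · exact Submodule.zero_mem _
  exact key hS

end

/-- `H(2k,2l;t)` with the supercommutator, graded by the parity of endomorphisms. -/
noncomputable instance instLieSuperalgebraH (F : Type*) [Field F] (p : ℕ) [Fact p.Prime]
    [CharP F p] {k : ℕ} (l : ℕ) (t : Fin (2 * k) → ℕ) : LieSuperalgebra F (H F p l t) where
  part a := (endPar F a).comap (H F p l t).subtype
  isCompl_part := by
    constructor
    · rw [Submodule.disjoint_def]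
      intro x h0 h1
      exact Subtype.ext (end_disjoint h0 h1)
    · rw [codisjoint_iff, Submodule.eq_top_iff']
      intro x
      refine Submodule.mem_sup.2 ⟨⟨_, endProj_mem_H 0 x.2⟩, endProj_mem 0 _,
        ⟨_, endProj_mem_H 1 x.2⟩, endProj_mem 1 _, ?_⟩
      exact Subtype.ext (endProj_add x.1)
  bracket := LinearMap.mk₂ F (fun x y => ⟨sbr F x.1 y.1, sbr_mem_H p x.2 y.2⟩)
    (fun x x' y => Subtype.ext (by simp)) (fun c x y => Subtype.ext (by simp))
    (fun x y y' => Subtype.ext (by simp)) (fun c x y => Subtype.ext (by simp))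
  bracket_mem hx hy := sbr_mem hx hy
  skew hx hy := Subtype.ext (sbr_skew hx hy)
  jacobi hx hy hz := Subtype.ext (sbr_jacobi hx hy hz)

end Ham

/-! The proof has a general half and a half special to `H`.

General half. Let `L` be a perfect Lie superalgebra with trivial center, in characteristic different
from 2. After a sign twist, a super-biderivation becomes a map `ψ` that is skew in the same sense as
the bracket and satisfies a Leibniz rule in each argument. Expanding ψ([x,u],[y,v]) in the two
possible orders gives a symmetry of the expression [ψ(x,y),[u,v]] ∓ [[x,y],ψ(u,v)]. Together with
skew-symmetry in x, y it makes a cyclic rotation of x, y, u act by a sign, and three rotations give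
minus the expression itself. Hence it vanishes (`IsSuperBider.bracket_comm_hom`). So if a sum of
tensors x ⊗ y is killed by the bracket, its image under `ψ` commutes with all [u,v] and is zero.
Therefore ψ(x,y) = γ([x,y]) for a linear map `γ` (`IsSuperBider.exists_factor`), and `γ` lies in the
supercentroid (`IsSuperBider.exists_centroid`). It remains to show that the supercentroid consists
of scalars, the scalar being zero in odd degree (`BDer_eq_IBDer`).

Special half. Write {f,g} = D_H(f)(g), so that D_H carries this bracket to the supercommutator, with
the constants as kernel. Integration by parts shows that brackets have no component along the top
monomial of Λ(m,n;t) (`H_le_span`). Conversely, all other monomials are produced by brackets: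
bracketing with a variable is a partial derivative up to a nonzero scalar, and the few monomials
that derivatives miss come from brackets with the quadratic elements x_{i'}^(2) and x_a x_{j'}
(`DH_mem_of_closed`). The same generation statement gives perfectness and reduces the centroid to
the variables. An element whose brackets with all variables vanish in `H` has constant first
derivatives; quadratic elements then detect these constants. This yields trivial center
(`H_isCenterless`), and it shows that a centroid element multiplies all the variables by one common
scalar (`H_centroid`). -/

namespace LieSuperalgebra

/-! ### The commutation identity for super-biderivations -/

section

variable {F L : Type*} [Field F] [AddCommGroup L] [Module F L] [LieSuperalgebra F L]

/-- A skew-symmetric super-biderivation of degree `g`, in the convention in which the map itself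
stands to the left of both arguments. -/
structure IsSuperBider (g : ZMod 2) (ψ : L →ₗ[F] L →ₗ[F] L) : Prop where
  mem : ∀ {a b : ZMod 2} {x y : L}, x ∈ part (F := F) a → y ∈ part (F := F) b →
    ψ x y ∈ part (F := F) (a + b + g)
  der : ∀ {a b : ZMod 2} {x y : L} (z : L), x ∈ part (F := F) a → y ∈ part (F := F) b →
    ψ x (bracket (F := F) y z) = bracket (F := F) (ψ x y) z +
      sgn F ((g + a) * b) • bracket (F := F) y (ψ x z)
  skew : ∀ {a b : ZMod 2} {x y : L}, x ∈ part (F := F) a → y ∈ part (F := F) b →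
    ψ x y = -(sgn F (a * b) • ψ y x)

/-- The Leibniz rule in the second argument is carried to the first by skew-symmetry. The sign
(-1)^(ga) is the cost of moving ψ past x. -/
theorem IsSuperBider.der_left {g : ZMod 2} {ψ : L →ₗ[F] L →ₗ[F] L} (h : IsSuperBider g ψ)
    {a b c : ZMod 2} {x y u : L} (hx : x ∈ part (F := F) a) (hu : u ∈ part (F := F) c)
    (hy : y ∈ part (F := F) b) :
    ψ (bracket (F := F) x u) y = sgn F (c * b) • bracket (F := F) (ψ x y) u +
      sgn F (g * a) • bracket (F := F) x (ψ u y) := by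
  rw [h.skew (bracket_mem hx hu) hy, h.der u hy hx, h.skew hy hx, h.skew hy hu]
  simp only [map_neg, map_smul, LinearMap.neg_apply, LinearMap.smul_apply]
  rcases Ham.zmod2_cases g with rfl | rfl <;> rcases Ham.zmod2_cases a with rfl | rfl <;>
  rcases Ham.zmod2_cases b with rfl | rfl <;> rcases Ham.zmod2_cases c with rfl | rfl <;>
  simp [sgn_zero, sgn_one, (by decide : (1 : ZMod 2) + 1 = 0)] <;> abel

/-- The failure of `[ψ(x, y), [u, v]] = ± [[x, y], ψ(u, v)]`, for `x`, `y` of total parity `e`. -/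
def defect (g e : ZMod 2) (ψ : L →ₗ[F] L →ₗ[F] L) (x y u v : L) : L :=
  bracket (F := F) (ψ x y) (bracket (F := F) u v) -
    sgn F (g * e) • bracket (F := F) (bracket (F := F) x y) (ψ u v)

theorem IsSuperBider.defect_swap_left {g : ZMod 2} {ψ : L →ₗ[F] L →ₗ[F] L}
    (h : IsSuperBider g ψ) {a b : ZMod 2} {x y : L} (hx : x ∈ part (F := F) a)
    (hy : y ∈ part (F := F) b) (u v : L) :
    defect g (a + b) ψ x y u v = -(sgn F (a * b) • defect g (b + a) ψ y x u v) := by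
  rw [defect, defect, h.skew hx hy, LieSuperalgebra.skew hx hy, add_comm b a]
  simp only [map_neg, map_smul, LinearMap.neg_apply, LinearMap.smul_apply]
  module

/-- Both sides measure the difference between two expansions of ψ([x,u],[y,v]): first argument
before the second, or second before the first. Equating them and regrouping with the Jacobi identity
leaves exactly the exchange of x and u. -/
theorem IsSuperBider.defect_swap_mid {g : ZMod 2} {ψ : L →ₗ[F] L →ₗ[F] L}
    (h : IsSuperBider g ψ) {a b c d : ZMod 2} {x y u v : L} (hx : x ∈ part (F := F) a)
    (hy : y ∈ part (F := F) b) (hu : u ∈ part (F := F) c) (hv : v ∈ part (F := F) d) :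
    defect g (a + b) ψ x y u v =
      sgn F (a * b + a * c + b * c) • defect g (c + b) ψ u y x v := by
  have e1 := h.der_left hx hu (bracket_mem hy hv)
  have e2 := h.der v (bracket_mem hx hu) hy
  rw [h.der v hx hy, h.der v hu hy] at e1
  rw [h.der_left hx hu hy, h.der_left hx hu hv, e1] at e2
  have j1 := jacobi (F := F) (h.mem hx hy) hu hv
  have j2 := jacobi (F := F) hx hy (h.mem hu hv)
  have j3 := jacobi (F := F) hx (h.mem hu hy) hv
  have j4 := jacobi (F := F) hy (h.mem hx hv) hu
  have k1 := LieSuperalgebra.skew hu (bracket_mem (h.mem hx hy) hv)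
  have k2 := LieSuperalgebra.skew (bracket_mem hu hy) (h.mem hx hv)
  have k3 := LieSuperalgebra.skew hu hy
  simp only [map_add, map_smul, LinearMap.add_apply, LinearMap.smul_apply] at e2
  rw [j2, j3, j4] at e2
  rw [k1] at j1
  nth_rewrite 2 [k3] at k2
  simp only [map_neg, map_smul, smul_neg, neg_neg] at k2
  rw [defect, defect, j1, k2]
  clear j1 j2 j3 j4 k1 k2 k3 e1
  -- From here on the double brackets are independent symbols. For each choice of parities the goal
  -- is plus or minus the comparison `e2`.
  generalize bracket (F := F) (bracket (F := F) (ψ x y) v) u = A1 at e2 ⊢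
  generalize bracket (F := F) (bracket (F := F) (ψ x y) u) v = A2 at e2 ⊢
  generalize bracket (F := F) (bracket (F := F) x y) (ψ u v) = A3 at e2 ⊢
  generalize bracket (F := F) (ψ x v) (bracket (F := F) y u) = A4 at e2 ⊢
  generalize bracket (F := F) (ψ u y) (bracket (F := F) x v) = A5 at e2 ⊢
  generalize bracket (F := F) y (bracket (F := F) x (ψ u v)) = A6 at e2 ⊢
  generalize bracket (F := F) (bracket (F := F) x (ψ u y)) v = A7 at e2 ⊢
  generalize bracket (F := F) (bracket (F := F) y (ψ x v)) u = A8 at e2 ⊢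
  clear hx hy hu hv h
  have h2 : (1 : ZMod 2) + 1 = 0 := by decide
  rcases Ham.zmod2_cases g with rfl | rfl <;> rcases Ham.zmod2_cases a with rfl | rfl <;>
  rcases Ham.zmod2_cases b with rfl | rfl <;> rcases Ham.zmod2_cases c with rfl | rfl <;>
  rcases Ham.zmod2_cases d with rfl | rfl <;>
  simp only [add_zero, zero_add, mul_one, mul_zero, h2, sgn_zero, sgn_one] at e2 ⊢ <;>
  first
    | linear_combination (norm := module) (-1 : F) • e2
    | linear_combination (norm := module) (1 : F) • e2

/-- The exchange of x and u followed by the exchange of the first two entries is a 3-cycle on x, y,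
u; one minus sign comes from skew-symmetry. -/
theorem IsSuperBider.defect_rotate {g : ZMod 2} {ψ : L →ₗ[F] L →ₗ[F] L}
    (h : IsSuperBider g ψ) {a b c d : ZMod 2} {x y u v : L} (hx : x ∈ part (F := F) a)
    (hy : y ∈ part (F := F) b) (hu : u ∈ part (F := F) c) (hv : v ∈ part (F := F) d) :
    defect g (a + b) ψ x y u v = -(sgn F (a * b + a * c) • defect g (b + c) ψ y u x v) := by
  rw [h.defect_swap_mid hx hy hu hv, h.defect_swap_left hu hy, smul_neg, smul_smul, sgn_add,
    mul_assoc, mul_comm c b, Ham.sgn_mul_self, mul_one]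

theorem IsSuperBider.bracket_comm_hom (h2 : (2 : F) ≠ 0) {g : ZMod 2} {ψ : L →ₗ[F] L →ₗ[F] L}
    (h : IsSuperBider g ψ) {a b c d : ZMod 2} {x y u v : L} (hx : x ∈ part (F := F) a)
    (hy : y ∈ part (F := F) b) (hu : u ∈ part (F := F) c) (hv : v ∈ part (F := F) d) :
    bracket (F := F) (ψ x y) (bracket (F := F) u v) =
      sgn F (g * (a + b)) • bracket (F := F) (bracket (F := F) x y) (ψ u v) := by
  -- Three rotations restore the arguments. The parity signs multiply to 1 and the three minus signs
  -- to -1, so the defect equals its own negative.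
  have e1 := h.defect_rotate hx hy hu hv
  rw [h.defect_rotate hy hu hx hv, h.defect_rotate hu hx hy hv] at e1
  simp only [smul_neg, neg_neg, smul_smul, ← sgn_add] at e1
  have e0 : a * b + a * c + (b * c + b * a + (c * a + c * b)) = 0 := by
    clear * -
    decide +revert
  rw [e0, sgn_zero, one_smul] at e1
  have e2 : (2 : F) • defect g (a + b) ψ x y u v = 0 := by
    rw [two_smul]
    nth_rewrite 1 [e1]
    exact neg_add_cancel _
  exact sub_eq_zero.1 ((smul_eq_zero.1 e2).resolve_left h2)

/-! ### Extension from homogeneous elements, and the parity twist -/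

theorem linearMap_ext_part {M : Type*} [AddCommMonoid M] [Module F M] {f f' : L →ₗ[F] M}
    (h : ∀ (a : ZMod 2) (x : L), x ∈ part (F := F) a → f x = f' x) : f = f' := by
  refine LinearMap.ext fun x => ?_
  obtain ⟨y, hy, z, hz, rfl⟩ := Submodule.mem_sup.1
    ((isCompl_part (F := F) (L := L)).sup_eq_top ▸ Submodule.mem_top (x := x))
  rw [map_add, map_add, h 0 y hy, h 1 z hz]

theorem bilin_ext_part {M : Type*} [AddCommMonoid M] [Module F M] {B B' : L →ₗ[F] L →ₗ[F] M}
    (h : ∀ (a b : ZMod 2) (x y : L), x ∈ part (F := F) a → y ∈ part (F := F) b →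
      B x y = B' x y) : B = B' :=
  linearMap_ext_part fun a x hx => linearMap_ext_part fun b y hy => h a b x y hx hy

variable (F L) in
/-- The linear map that multiplies elements of parity `a` by `(-1)^(e a)`. -/
noncomputable def twist (e : ZMod 2) : L →ₗ[F] L :=
  LinearMap.ofIsCompl isCompl_part (part (F := F) 0).subtype
    (sgn F e • (part (F := F) 1).subtype)

theorem twist_apply (e : ZMod 2) {a : ZMod 2} {x : L} (hx : x ∈ part (F := F) a) :
    twist F L e x = sgn F (e * a) • x := by
  rcases Ham.zmod2_cases a with rfl | rfl
  · rw [mul_zero, sgn_zero, one_smul]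
    exact LinearMap.ofIsCompl_apply_left isCompl_part ⟨x, hx⟩
  · rw [mul_one]
    exact LinearMap.ofIsCompl_apply_right isCompl_part ⟨x, hx⟩

/-- As 2 is invertible, the even and odd parts are the eigenspaces of the parity involution for 1
and -1. This turns homogeneity into a linear equation. -/
theorem mem_part_of_twist (h2 : (2 : F) ≠ 0) {a : ZMod 2} {x : L}
    (h : twist F L 1 x = sgn F a • x) : x ∈ part (F := F) a := by
  obtain ⟨y, hy, z, hz, rfl⟩ := Submodule.mem_sup.1
    ((isCompl_part (F := F) (L := L)).sup_eq_top ▸ Submodule.mem_top (x := x))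
  rw [map_add, twist_apply 1 hy, twist_apply 1 hz, mul_zero, mul_one, sgn_zero, sgn_one] at h
  rcases Ham.zmod2_cases a with rfl | rfl
  · have : (2 : F) • z = 0 := by
      rw [sgn_zero] at h
      linear_combination (norm := module) (-1 : F) • h
    rw [(smul_eq_zero.1 this).resolve_left h2, add_zero]
    exact hy
  · have : (2 : F) • y = 0 := by
      rw [sgn_one] at h
      linear_combination (norm := module) (1 : F) • h
    rw [(smul_eq_zero.1 this).resolve_left h2, zero_add]
    exact hz

/-- The sign in the homogeneous identity depends only on the parity of [x,y], so it can be absorbed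
into `twist`. Both sides are then bilinear in x, y, and the identity extends to arbitrary sums of
tensors. -/
theorem IsSuperBider.bracket_comm (h2 : (2 : F) ≠ 0) {g : ZMod 2} {ψ : L →ₗ[F] L →ₗ[F] L}
    (h : IsSuperBider g ψ) (x y u v : L) :
    bracket (F := F) (ψ x y) (bracket (F := F) u v) =
      bracket (F := F) (twist F L g (bracket (F := F) x y)) (ψ u v) := by
  have h1 : ∀ {a b : ZMod 2} {x y : L}, x ∈ part (F := F) a → y ∈ part (F := F) b →
      (bracket (F := F)).compr₂ (bracket (F := F) (ψ x y)) =
      ψ.compr₂ (bracket (F := F) (twist F L g (bracket (F := F) x y))) := by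
    intro a b x y hx hy
    refine bilin_ext_part fun c d u v hu hv => ?_
    rw [LinearMap.compr₂_apply, LinearMap.compr₂_apply, h.bracket_comm_hom h2 hx hy hu hv,
      twist_apply g (bracket_mem hx hy), map_smul, LinearMap.smul_apply]
  have h3 : ψ.compr₂ ((bracket (F := F)).flip (bracket (F := F) u v)) =
      (bracket (F := F)).compr₂ ((bracket (F := F)).flip (ψ u v) ∘ₗ twist F L g) :=
    bilin_ext_part fun a b x y hx hy => LinearMap.congr_fun (LinearMap.congr_fun (h1 hx hy) u) v
  exact LinearMap.congr_fun (LinearMap.congr_fun h3 x) y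

/-! ### From super-biderivations to the centroid -/

variable (F L) in
/-- `L` is spanned by its brackets. -/
def IsPerfect : Prop :=
  Submodule.span F (Set.range fun q : L × L => bracket (F := F) q.1 q.2) = ⊤

variable (F L) in
/-- The center of `L` is trivial. -/
def IsCenterless : Prop :=
  ∀ z : L, (∀ y, bracket (F := F) z y = 0) → z = 0

/-- It suffices to test centrality from the left. -/
theorem isCenterless_of_right (h : ∀ z : L, (∀ y, bracket (F := F) y z = 0) → z = 0) :
    IsCenterless F L := by
  intro z hz
  obtain ⟨z₀, h₀, z₁, h₁, rfl⟩ := Submodule.mem_sup.1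
    ((isCompl_part (F := F) (L := L)).sup_eq_top ▸ Submodule.mem_top (x := z))
  have key : ∀ (b : ZMod 2) (y : L), y ∈ part (F := F) b → bracket (F := F) z₀ y = 0 := by
    intro b y hy
    have e := hz y
    rw [map_add, LinearMap.add_apply] at e
    have m₀ := bracket_mem h₀ hy
    have m₁ := bracket_mem h₁ hy
    -- Since [z₀,y] = -[z₁,y], this element is homogeneous of both parities and therefore zero.
    rw [← neg_eq_of_add_eq_zero_right e, Submodule.neg_mem_iff] at m₁
    have hd := Submodule.disjoint_def.1 (isCompl_part (F := F) (L := L)).disjoint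
    rcases Ham.zmod2_cases b with rfl | rfl
    · exact hd _ m₀ m₁
    · exact hd _ m₁ m₀
  have h0 : z₀ = 0 := h _ fun y => LinearMap.congr_fun (f := (bracket (F := F)).flip z₀) (g := 0)
    (linearMap_ext_part fun b y hy => by
      rw [LinearMap.flip_apply, LieSuperalgebra.skew hy h₀, key b y hy]
      simp) y
  have h1 : z₁ = 0 := h _ fun y => LinearMap.congr_fun (f := (bracket (F := F)).flip z₁) (g := 0)
    (linearMap_ext_part fun b y hy => by
      have e := hz y
      rw [h0, zero_add] at e
      rw [LinearMap.flip_apply, LieSuperalgebra.skew hy h₁, e]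
      simp) y
  rw [h0, h1, add_zero]

theorem IsPerfect.linearMap_ext (hL : IsPerfect F L) {M : Type*} [AddCommMonoid M] [Module F M]
    {f f' : L →ₗ[F] M}
    (h : ∀ (a b : ZMod 2) (x y : L), x ∈ part (F := F) a → y ∈ part (F := F) b →
      f (bracket (F := F) x y) = f' (bracket (F := F) x y)) : f = f' := by
  refine LinearMap.ext_on_range hL fun q => ?_
  exact LinearMap.congr_fun (LinearMap.congr_fun (bilin_ext_part
    (B := (bracket (F := F)).compr₂ f) (B' := (bracket (F := F)).compr₂ f') h) q.1) q.2

/-- View bracket and ψ as maps `T`, `S` on L ⊗ L. By perfectness `T` is onto, and by the commutation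
identity ker T ⊆ ker S, so ψ factors as γ after the bracket. Reading the same identity on elements
written as sums of brackets moves γ from one side of a bracket to the other. -/
theorem IsSuperBider.exists_factor (h2 : (2 : F) ≠ 0) (hL : IsPerfect F L)
    (hc : IsCenterless F L) {g : ZMod 2} {ψ : L →ₗ[F] L →ₗ[F] L} (h : IsSuperBider g ψ) :
    ∃ γ : L →ₗ[F] L, (∀ x y, ψ x y = γ (bracket (F := F) x y)) ∧
      (∀ {a : ZMod 2} {x : L}, x ∈ part (F := F) a → γ x ∈ part (F := F) (a + g)) ∧
      ∀ {a : ZMod 2} {x : L} (y : L), x ∈ part (F := F) a →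
        bracket (F := F) (γ x) y = sgn F (g * a) • bracket (F := F) x (γ y) := by
  let T := TensorProduct.lift (bracket (F := F) (L := L))
  let S := TensorProduct.lift ψ
  have hT : LinearMap.range T = ⊤ := by
    refine eq_top_iff.2 (hL.symm.le.trans (Submodule.span_le.2 ?_))
    rintro _ ⟨q, rfl⟩
    exact ⟨q.1 ⊗ₜ q.2, TensorProduct.lift.tmul _ _⟩
  obtain ⟨s, hs⟩ := T.exists_rightInverse_of_surjective hT
  -- [S t, [u,v]] = ±[T t, ψ(u,v)] with the sign hidden in `twist`. If T t = 0, then S t commutes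
  -- with all brackets, hence with L, and the trivial center gives S t = 0.
  have key : ∀ t, T t = 0 → S t = 0 := by
    intro t ht
    refine hc _ fun w => ?_
    refine LinearMap.congr_fun (f := bracket (F := F) (S t)) (g := 0)
      (hL.linearMap_ext fun _ _ u v _ _ => ?_) w
    have : (bracket (F := F)).flip (bracket (F := F) u v) ∘ₗ S =
        (bracket (F := F)).flip (ψ u v) ∘ₗ twist F L g ∘ₗ T :=
      TensorProduct.ext' fun x y => by
        simpa [S, T] using h.bracket_comm h2 x y u v
    have := LinearMap.congr_fun this t
    simpa [ht] using this
  have hγ : ∀ x y, ψ x y = (S ∘ₗ s) (bracket (F := F) x y) := by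
    intro x y
    have h1 : T (x ⊗ₜ y - s (bracket (F := F) x y)) = 0 := by
      rw [map_sub, show T (s (bracket (F := F) x y)) = _ from LinearMap.congr_fun hs _]
      simp [T]
    have h3 := key _ h1
    rw [map_sub, sub_eq_zero] at h3
    simpa [S] using h3
  generalize S ∘ₗ s = γ at hγ
  refine ⟨γ, hγ, fun {a x} hx => ?_, fun {a x} y hx => ?_⟩
  · refine mem_part_of_twist h2 ?_
    -- γ is known only on brackets, so its degree is tested by commuting it with the parity
    -- involution, which can be checked there.
    have h3 : twist F L 1 ∘ₗ γ = sgn F g • (γ ∘ₗ twist F L 1) :=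
      hL.linearMap_ext fun b c u v hu hv => by
        simp only [LinearMap.comp_apply, LinearMap.smul_apply]
        rw [← hγ, twist_apply 1 (h.mem hu hv), twist_apply 1 (bracket_mem hu hv), map_smul, ← hγ,
          smul_smul, one_mul, one_mul, ← sgn_add, add_comm g]
    have h4 := LinearMap.congr_fun h3 x
    simp only [LinearMap.comp_apply, LinearMap.smul_apply] at h4
    rw [h4, twist_apply 1 hx, map_smul, smul_smul, one_mul, ← sgn_add, add_comm g]
  · have h3 : ∀ u v, (bracket (F := F)).flip (bracket (F := F) u v) ∘ₗ γ =
        (bracket (F := F)).flip (γ (bracket (F := F) u v)) ∘ₗ twist F L g := fun u v =>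
      hL.linearMap_ext fun b c x y hx hy => by
        simp only [LinearMap.comp_apply, LinearMap.flip_apply]
        rw [← hγ, ← hγ]
        exact h.bracket_comm h2 x y u v
    have h4 : bracket (F := F) (γ x) = sgn F (g * a) • (bracket (F := F) x ∘ₗ γ) :=
      hL.linearMap_ext fun b c u v hu hv => by
        have := LinearMap.congr_fun (h3 u v) x
        simp only [LinearMap.comp_apply, LinearMap.flip_apply] at this
        rw [this, twist_apply g hx]
        simp
    exact LinearMap.congr_fun h4 y

/-- On a perfect centerless Lie superalgebra, skew-symmetric super-biderivations come from the
centroid. -/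
theorem IsSuperBider.exists_centroid (h2 : (2 : F) ≠ 0) (hL : IsPerfect F L)
    (hc : IsCenterless F L) {g : ZMod 2} {ψ : L →ₗ[F] L →ₗ[F] L} (h : IsSuperBider g ψ) :
    ∃ γ : L →ₗ[F] L, (∀ x y, ψ x y = γ (bracket (F := F) x y)) ∧
      (∀ {a : ZMod 2} {x : L}, x ∈ part (F := F) a → γ x ∈ part (F := F) (a + g)) ∧
      (∀ x y, γ (bracket (F := F) x y) = bracket (F := F) (γ x) y) ∧
      ∀ {a : ZMod 2} {x : L} (y : L), x ∈ part (F := F) a →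
        γ (bracket (F := F) x y) = sgn F (g * a) • bracket (F := F) x (γ y) := by
  obtain ⟨γ, hψ, hmem, hγ⟩ := h.exists_factor h2 hL hc
  -- The map (x,y) ↦ [γ(x),y] is again a super-biderivation: Leibniz is the Jacobi identity, and
  -- skew-symmetry is the rule `hγ` for moving γ across the bracket. So it factors through the
  -- bracket as well, by some π, and the claim becomes π = γ.
  have hP : IsSuperBider g (bracket (F := F) ∘ₗ γ) :=
    { mem := fun {a b x y} hx hy => by
        rw [add_right_comm]
        exact bracket_mem (hmem hx) hy
      der := fun {a b x y} z hx hy => by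
        refine (LinearMap.congr_fun (linearMap_ext_part (f := bracket (F := F) (γ x) ∘ₗ
          bracket (F := F) y) (f' := bracket (F := F) (bracket (F := F) (γ x) y) +
          sgn F ((a + g) * b) • (bracket (F := F) y ∘ₗ bracket (F := F) (γ x)))
          fun c z hz => ?_) z).trans ?_
        · exact jacobi (hmem hx) hy hz
        · rw [add_comm a g]
          rfl
      skew := fun {a b x y} hx hy => by
        simp only [LinearMap.comp_apply]
        rw [hγ y hx, LieSuperalgebra.skew hx (hmem hy), smul_neg, smul_smul, ← sgn_add]
        congr 3
        clear * -
        decide +revert }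
  obtain ⟨π, hπ, -, -⟩ := hP.exists_factor h2 hL hc
  simp only [LinearMap.comp_apply] at hπ
  -- γ([x,[y,z]]) = ψ(x,[y,z]) is expanded by Leibniz into [γ([x,y]),z] ± [y,γ([x,z])]. Each term is
  -- a value of π, and Jacobi reassembles them into π([x,[y,z]]).
  have h3 : ∀ {a b c : ZMod 2} {x y z : L}, x ∈ part (F := F) a → y ∈ part (F := F) b →
      z ∈ part (F := F) c → γ (bracket (F := F) x (bracket (F := F) y z)) =
        π (bracket (F := F) x (bracket (F := F) y z)) := by
    intro a b c x y z hx hy hz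
    have h5 := hγ (bracket (F := F) x z) hy
    rw [hπ] at h5
    rw [jacobi hx hy hz, ← jacobi hx hy hz, ← hψ, h.der z hx hy, hψ, hψ, hπ, jacobi hx hy hz,
      map_add, map_smul, h5, smul_smul, ← sgn_add]
    congr 3
    clear * -
    decide +revert
  -- Perfectness applied twice: elements of the form [x,[y,z]] span L.
  have h4 : γ = π := hL.linearMap_ext fun a b x y hx hy =>
    LinearMap.congr_fun (f := γ ∘ₗ bracket (F := F) x) (g := π ∘ₗ bracket (F := F) x)
      (hL.linearMap_ext fun b c y z hy hz => h3 hx hy hz) y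
  have h6 : ∀ x y, γ (bracket (F := F) x y) = bracket (F := F) (γ x) y := fun x y => by
    rw [hπ, h4]
  exact ⟨γ, hψ, hmem, h6, fun y hx => (h6 _ y).trans (hγ y hx)⟩

/-- Multiplying φ(x,·) by (-1)^(g d(x)) removes the two signs involving g from the skew-symmetry
rule and does not affect Leibniz in the second argument. -/
theorem homBDer_isSuperBider {g : ZMod 2} {φ : L →ₗ[F] L →ₗ[F] L} (h : φ ∈ homBDer F L g) :
    IsSuperBider g (φ ∘ₗ twist F L g) where
  mem hx hy := by
    rw [LinearMap.comp_apply, twist_apply g hx, map_smul, LinearMap.smul_apply]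
    exact Submodule.smul_mem _ _ (h.1 _ _ _ _ hx hy)
  der z hx hy := by
    rw [LinearMap.comp_apply, twist_apply g hx, map_smul]
    simp only [LinearMap.smul_apply]
    rw [h.2.1 _ _ _ _ z hx hy, smul_add, map_smul, map_smul, LinearMap.smul_apply, smul_comm]
  skew {a b x y} hx hy := by
    simp only [LinearMap.comp_apply]
    rw [twist_apply g hx, twist_apply g hy, map_smul, map_smul]
    simp only [LinearMap.smul_apply]
    rw [h.2.2 _ _ _ _ hx hy, smul_neg, smul_smul, smul_smul, ← sgn_add, ← sgn_add]
    congr 3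
    clear * -
    decide +revert

theorem IBDer_le_BDer : IBDer F L ≤ BDer F L := by
  rintro φ ⟨c, hc⟩
  have hφ : φ = c • bracket (F := F) := LinearMap.ext fun x => LinearMap.ext fun y => hc x y
  rw [hφ]
  refine Submodule.smul_mem _ _ (Submodule.mem_sup_left ⟨fun a b x y hx hy => ?_,
    fun a b x y z hx hy => ?_, fun a b x y hx hy => ?_⟩)
  · rw [add_zero]
    exact bracket_mem hx hy
  · rw [zero_add]
    exact LinearMap.congr_fun (linearMap_ext_part (f := bracket (F := F) x ∘ₗ
      bracket (F := F) y) (f' := bracket (F := F) (bracket (F := F) x y) +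
      sgn F (a * b) • (bracket (F := F) y ∘ₗ bracket (F := F) x))
      fun c z hz => jacobi hx hy hz) z
  · rw [zero_mul, zero_mul, zero_add, zero_add]
    exact LieSuperalgebra.skew hx hy

/-- If the centroid of a perfect centerless Lie superalgebra consists of scalars, then all its
skew-symmetric super-biderivations are inner. -/
theorem BDer_eq_IBDer (h2 : (2 : F) ≠ 0) (hL : IsPerfect F L) (hc : IsCenterless F L)
    (hs : ∀ (g : ZMod 2) (γ : L →ₗ[F] L),
      (∀ {a : ZMod 2} {x : L}, x ∈ part (F := F) a → γ x ∈ part (F := F) (a + g)) →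
      (∀ x y, γ (bracket (F := F) x y) = bracket (F := F) (γ x) y) →
      (∀ {a : ZMod 2} {x : L} (y : L), x ∈ part (F := F) a →
        γ (bracket (F := F) x y) = sgn F (g * a) • bracket (F := F) x (γ y)) →
      ∃ c : F, (g = 1 → c = 0) ∧ ∀ x, γ x = c • x) :
    BDer F L = IBDer F L := by
  refine le_antisymm (sup_le ?_ ?_) IBDer_le_BDer
  all_goals
    intro φ hφ
    obtain ⟨γ, h1, h3, h4, h5⟩ := (homBDer_isSuperBider hφ).exists_centroid h2 hL hc
    obtain ⟨c, hc0, hc⟩ := hs _ γ h3 h4 h5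
    refine ⟨c, fun x y => LinearMap.congr_fun (f := φ.flip y)
      (g := c • (bracket (F := F)).flip y) (linearMap_ext_part fun a x hx => ?_) x⟩
    have h6 := h1 x y
    rw [hc, LinearMap.comp_apply, twist_apply _ hx, map_smul, LinearMap.smul_apply] at h6
  · rw [zero_mul, sgn_zero, one_smul] at h6
    exact h6
  -- In odd degree the scalar is zero, so φ(x,y) vanishes up to a twist sign, and that sign is
  -- invertible.
  · rw [hc0 rfl, zero_smul, smul_eq_zero] at h6
    rw [hc0 rfl, zero_smul]
    refine h6.resolve_left fun h7 => ?_
    have := Ham.sgn_mul_self (F := F) (1 * a)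
    rw [h7, zero_mul] at this
    exact zero_ne_one this

end

end LieSuperalgebra

namespace Ham

/-! ### Variables, constants and coefficients in Λ(m,n) -/

section

variable {F : Type*} [Field F] {m n : ℕ}

/-- The index of the variable `x_i`. -/
def var : Fin m ⊕ Fin n → Mon m n
  | Sum.inl i => (Pi.single i 1, ∅)
  | Sum.inr j => (0, {j})

theorem deg_var (i : Fin m ⊕ Fin n) : deg (var i) = tau i := by
  rcases i with i | j <;> simp [deg, var, tau]

theorem var_mem_par (i : Fin m ⊕ Fin n) : e F (var i) ∈ par F (tau i) :=
  e_mem_par' (deg_var i)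

theorem e_ne_zero (a : Mon m n) : e F a ≠ 0 :=
  fun h => one_ne_zero ((Finsupp.single_eq_zero (a := a) (b := (1 : F))).1 h)

theorem D_one (i : Fin m ⊕ Fin n) : D F i (e F (0, ∅)) = 0 := by
  rw [D_e]
  rcases i with i | j <;> simp [DMon]

theorem D_var (i j : Fin m ⊕ Fin n) :
    D F i (e F (var j)) = if i = j then e F (0, ∅) else 0 := by
  rw [D_e]
  rcases i with i | i <;> rcases j with j | j
  · by_cases h : i = j
    · subst h
      simp [DMon, var]
    · simp [DMon, var, h]
  · simp [DMon, var]
  · simp [DMon, var]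
  · by_cases h : i = j
    · subst h
      simp [DMon, var, Finset.filter_singleton]
    · simp [DMon, var, h]

theorem mul_one' (f : Lam F m n) : mul F f (e F (0, ∅)) = f := by
  have : (mul F).flip (e F (0, ∅)) = (LinearMap.id : Module.End F (Lam F m n)) :=
    lam_ext fun a => by
      rw [LinearMap.flip_apply, mul_e_e]
      simp [mulMon, inv]
  exact LinearMap.congr_fun this f

theorem one_mul' (f : Lam F m n) : mul F (e F (0, ∅)) f = f := by
  have : mul F (e F (0, ∅)) = (LinearMap.id : Module.End F (Lam F m n)) :=
    lam_ext fun a => by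
      rw [mul_e_e]
      simp [mulMon, inv]
  exact LinearMap.congr_fun this f

/-- The divided-power coefficient is binom(α_i, 1). It may vanish mod p, but not at the maximal
exponent p^(t_i) - 1, which becomes -1 in F; that is the case needed later. -/
theorem mul_var_inl {α : Fin m → ℕ} {i : Fin m} (h : α i ≠ 0) (u : Finset (Fin n)) :
    mul F (e F (var (Sum.inl i))) (e F (α - Pi.single i 1, u)) = (α i : F) • e F (α, u) := by
  rw [mul_e_e, mulMon, if_pos (by simp [var])]
  simp only [var]
  have h1 : Pi.single i 1 + (α - Pi.single i 1) = α := by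
    ext r
    by_cases hr : r = i
    · subst hr
      simp
      omega
    · simp [hr]
  have h2 : ∏ r, ((((Pi.single i 1 : Fin m → ℕ) r + (α - Pi.single i 1 : Fin m → ℕ) r).choose
      ((Pi.single i 1 : Fin m → ℕ) r) : ℕ) : F) = α i := by
    rw [Finset.prod_eq_single i]
    · rw [← Pi.add_apply, h1]
      simp
    · intro r _ hr
      simp [hr]
    · simp
  rw [h1, h2]
  simp [inv]

/-- The coefficient of a basis element. -/
noncomputable def coeff (F : Type*) [Field F] {m n : ℕ} (b : Mon m n) : Lam F m n →ₗ[F] F :=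
  lift F fun a => if a = b then 1 else 0

theorem coeff_e (a b : Mon m n) : coeff F b (e F a) = if a = b then 1 else 0 := lc_e _ _

theorem eq_zero_of_coeff {f : Lam F m n} (h : ∀ b, coeff F b f = 0) : f = 0 := by
  have h1 : ∀ b, coeff F b = (Finsupp.lapply b : (Mon m n →₀ F) →ₗ[F] F) := fun b =>
    lam_ext fun a => by
      rw [coeff_e]
      exact (Finsupp.single_apply).symm
  refine Finsupp.ext fun b => ?_
  have := h b
  rw [h1 b] at this
  exact this

/-- The elements killed by all `D_i` are the constants. -/
theorem exists_const_of_D {f : Lam F m n} (h : ∀ i, D F i f = 0) :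
    ∃ c : F, f = c • e F (0, ∅) := by
  refine ⟨coeff F (0, ∅) f, sub_eq_zero.1 (eq_zero_of_coeff fun b => ?_)⟩
  rw [map_sub, map_smul, coeff_e, smul_eq_mul]
  by_cases hb : b = (0, ∅)
  · rw [hb, if_pos rfl, mul_one, sub_self]
  rw [if_neg (Ne.symm hb), mul_zero, sub_zero]
  -- A nonconstant basis element can be lowered by some D_i. With divided powers the coefficient is
  -- carried over up to sign, so no exponent has to be inverted in characteristic p.
  obtain ⟨β, u⟩ := b
  by_cases hβ : β = 0
  · have hu : u.Nonempty := by
      rw [Finset.nonempty_iff_ne_empty]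
      rintro rfl
      exact hb (by rw [hβ])
    obtain ⟨j, hj⟩ := hu
    have h1 : coeff F (β, u.erase j) ∘ₗ D F (Sum.inr j) =
        (-1 : F) ^ (u.filter (· < j)).card • coeff F (β, u) := lam_ext fun a => by
      obtain ⟨α, v⟩ := a
      rw [LinearMap.comp_apply, D_e, LinearMap.smul_apply, coeff_e]
      simp only [DMon]
      split_ifs with h2 h3 h3
      · obtain ⟨rfl, rfl⟩ := Prod.mk.inj h3
        rw [map_smul, coeff_e, if_pos rfl]
      · rw [map_smul, coeff_e, if_neg, smul_zero, smul_zero]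
        intro h4
        obtain ⟨h4, h5⟩ := Prod.ext_iff.1 h4
        refine h3 (Prod.ext h4 ?_)
        simp only at h5 ⊢
        rw [← Finset.insert_erase h2, h5, Finset.insert_erase hj]
      · exact absurd ((Prod.mk.inj h3).2.symm ▸ hj) h2
      · rw [map_zero, smul_zero]
    have h2 := LinearMap.congr_fun h1 f
    rw [LinearMap.comp_apply, h, map_zero, LinearMap.smul_apply] at h2
    exact (smul_eq_zero.1 h2.symm).resolve_left (pow_ne_zero _ (by simp))
  · obtain ⟨i, hi⟩ := Function.ne_iff.1 hβ
    have h1 : coeff F (β - Pi.single i 1, u) ∘ₗ D F (Sum.inl i) = coeff F (β, u) :=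
      lam_ext fun a => by
        obtain ⟨α, v⟩ := a
        rw [LinearMap.comp_apply, D_e, coeff_e]
        simp only [DMon]
        split_ifs with h2 h3 h3
        · exact absurd ((congrFun (Prod.ext_iff.1 h3).1 i).symm.trans h2) hi
        · rw [map_zero]
        · obtain ⟨rfl, rfl⟩ := Prod.mk.inj h3
          rw [coeff_e, if_pos rfl]
        · rw [coeff_e, if_neg]
          intro h4
          obtain ⟨h4, h5⟩ := Prod.ext_iff.1 h4
          refine h3 (Prod.ext (funext fun r => ?_) h5)
          have h6 := congrFun h4 r
          simp only [Pi.sub_apply] at h6 ⊢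
          by_cases hr : r = i
          · subst hr
            simp only [Pi.zero_apply, Pi.single_eq_same] at h6 hi
            omega
          · simpa [hr] using h6
    have h2 := LinearMap.congr_fun h1 f
    rw [LinearMap.comp_apply, h, map_zero] at h2
    exact h2.symm

end

/-! ### The map D_H on variables, and its kernel -/

section

variable {F : Type*} [Field F] {k l : ℕ}

theorem sgn_ne_zero (a : ZMod 2) : sgn F a ≠ 0 := fun h => by
  have := sgn_mul_self (F := F) a
  rw [h, zero_mul] at this
  exact zero_ne_one this

theorem cf_ne_zero (a : ZMod 2) (i : Fin (2 * k) ⊕ Fin (2 * l)) : cf F a i ≠ 0 := by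
  refine mul_ne_zero ?_ (sgn_ne_zero _)
  generalize conj i = j
  rcases j with j | j
  · simp only [sigma]
    split_ifs <;> simp
  · simp [sigma]

theorem halfConj_ne (i : Fin (2 * k)) : halfConj i ≠ i := by
  intro h
  have := congrArg Fin.val h
  unfold halfConj at this
  split_ifs at this <;> simp at this <;> omega

/-- Both sides are bilinear in f, g, so the homogeneity assumptions of `DH_bracket` can be dropped.
-/
theorem sbr_DH (f g : Lam F (2 * k) (2 * l)) : sbr F (DH F f) (DH F g) = DH F (DH F f g) := by
  have h1 : ∀ a, sbr F (DH F (e F a)) ∘ₗ DH F = DH F (k := k) (l := l) ∘ₗ DH F (e F a) :=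
    fun a => lam_ext fun b => DH_bracket (e_mem_par a) (e_mem_par b)
  have h2 : (sbr F).flip (DH F g) ∘ₗ DH F = DH F (k := k) (l := l) ∘ₗ (DH F).flip g :=
    lam_ext fun a => LinearMap.congr_fun (h1 a) g
  exact LinearMap.congr_fun h2 f

theorem DH_var (i : Fin (2 * k) ⊕ Fin (2 * l)) (f : Lam F (2 * k) (2 * l)) :
    DH F (e F (var i)) f = cf F (tau i) (conj i) • D F (conj i) f := by
  rw [DH_apply (var_mem_par i), Finset.sum_eq_single (conj i)]
  · rw [conj_conj, D_var, if_pos rfl, one_mul']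
  · intro j _ hj
    rw [D_var, if_neg, map_zero, LinearMap.zero_apply, smul_zero]
    rintro rfl
    exact hj (conj_conj j).symm
  · simp

/-- If all `D_j(f)` are constants, then `D_H(q)(f)` is a combination of the `D_j(q)`. -/
theorem DH_of_D_const {a : ZMod 2} {q f : Lam F (2 * k) (2 * l)} (hq : q ∈ par F a)
    {c : Fin (2 * k) ⊕ Fin (2 * l) → F} (hc : ∀ j, D F j f = c j • e F (0, ∅)) :
    DH F q f = ∑ j, (cf F a j * c j) • D F (conj j) q := by
  rw [DH_apply hq]
  refine Finset.sum_congr rfl fun j _ => ?_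
  rw [hc, map_smul, mul_one', smul_smul]

theorem DH_apply_var {a : ZMod 2} {q : Lam F (2 * k) (2 * l)} (hq : q ∈ par F a)
    (i : Fin (2 * k) ⊕ Fin (2 * l)) :
    DH F q (e F (var i)) = cf F a i • D F (conj i) q := by
  rw [DH_of_D_const hq (c := fun j => if j = i then 1 else 0), Finset.sum_eq_single i]
  · rw [if_pos rfl, mul_one]
  · intro j _ hj
    rw [if_neg hj, mul_zero, zero_smul]
  · simp
  · intro j
    rw [D_var]
    split_ifs <;> simp

theorem DH_one : DH F (e F (0, ∅) : Lam F (2 * k) (2 * l)) = 0 := by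
  refine LinearMap.ext fun h => ?_
  rw [DH_apply (e_mem_par _)]
  simp [D_one]

theorem DH_eq_zero_of_D {f : Lam F (2 * k) (2 * l)} (h : ∀ i, D F i f = 0) : DH F f = 0 := by
  obtain ⟨c, rfl⟩ := exists_const_of_D h
  rw [map_smul, DH_one, smul_zero]

/-- For homogeneous f the operator D_H(f) sends x_{i'} to a nonzero multiple of D_i(f). In general
its even and odd components vanish separately. -/
theorem D_eq_zero_of_DH {f : Lam F (2 * k) (2 * l)} (h : DH F f = 0)
    (i : Fin (2 * k) ⊕ Fin (2 * l)) : D F i f = 0 := by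
  have h1 : ∀ (b : ZMod 2) (g : Lam F (2 * k) (2 * l)), g ∈ par F b → DH F g = 0 →
      D F i g = 0 := by
    intro b g hg hg0
    have := DH_apply_var hg (conj i)
    rw [hg0, conj_conj, LinearMap.zero_apply] at this
    exact (smul_eq_zero.1 this.symm).resolve_left (cf_ne_zero _ _)
  have h2 := parProj_add 0 f
  rw [← h2, map_add] at h
  have m0 := DH_mem (parProj_mem 0 f)
  have m1 := DH_mem (parProj_mem (0 + 1) f)
  have h3 : DH F (parProj F 0 f) = 0 := by
    refine end_disjoint m0 ?_
    rw [eq_neg_of_add_eq_zero_left h]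
    exact Submodule.neg_mem _ m1
  rw [h3, zero_add] at h
  rw [← h2, map_add, h1 _ _ (parProj_mem 0 f) h3, h1 _ _ (parProj_mem _ f) h, add_zero]

end

end Ham

namespace Ham

/-! ### All monomials but the top one: spanning and generation -/

section

variable {F : Type*} [Field F] {k l : ℕ}

/-- The indices of the basis elements of `Λ(m,n;t)` other than the top one. -/
def properMon (p l : ℕ) (t : Fin (2 * k) → ℕ) : Set (Mon (2 * k) (2 * l)) :=
  {a | a ∈ truncMon p l t ∧ a ≠ (fun i => p ^ t i - 1, Finset.univ)}

theorem proper_of_lt {p : ℕ} {t : Fin (2 * k) → ℕ} {a : Mon (2 * k) (2 * l)}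
    (ha : a ∈ truncMon p l t) (i : Fin (2 * k)) (hi : a.1 i + 1 < p ^ t i) :
    a ∈ properMon p l t := by
  refine ⟨ha, fun h => ?_⟩
  rw [h] at hi
  simp only at hi
  omega

theorem proper_of_notMem {p : ℕ} {t : Fin (2 * k) → ℕ} {a : Mon (2 * k) (2 * l)}
    (ha : a ∈ truncMon p l t) (j : Fin (2 * l)) (hj : j ∉ a.2) : a ∈ properMon p l t := by
  refine ⟨ha, fun h => ?_⟩
  rw [h] at hj
  exact hj (Finset.mem_univ _)

/-- A derivative lowers an exponent or deletes an odd variable, so the top monomial never occurs in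
it. -/
theorem D_mem_span_proper {p : ℕ} {t : Fin (2 * k) → ℕ} (i : Fin (2 * k) ⊕ Fin (2 * l))
    {f : Lam F (2 * k) (2 * l)} (hf : f ∈ truncLam F p l t) :
    D F i f ∈ Submodule.span F (e F '' properMon p l t) := by
  have key : truncLam F p l t ≤
      (Submodule.span F (e F '' properMon p l t)).comap (D F i) := by
    refine Submodule.span_le.2 ?_
    rintro _ ⟨a, ha, rfl⟩
    change D F i (e F a) ∈ Submodule.span F (e F '' properMon p l t)
    rw [D_e]
    rcases i with i | j
    · simp only [DMon]
      split_ifs with h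
      · exact Submodule.zero_mem _
      · refine Submodule.subset_span ⟨_, proper_of_lt
          (fun r => lt_of_le_of_lt (Nat.sub_le _ _) (ha r)) i ?_, rfl⟩
        have := ha i
        simp only [Pi.sub_apply, Pi.single_eq_same]
        omega
    · simp only [DMon]
      split_ifs with h
      · exact Submodule.smul_mem _ _ (Submodule.subset_span ⟨(a.1, a.2.erase j),
          proper_of_notMem ha j (Finset.notMem_erase _ _), rfl⟩)
      · exact Submodule.zero_mem _
  exact key hf

/-- Reindexing by i ↦ i' negates the sum: D_i and D_{i'} commute up to (-1)^τ(i), while σ changes by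
-(-1)^τ(i). -/
theorem sum_sigma_D_D (h2 : (2 : F) ≠ 0) (g : Lam F (2 * k) (2 * l)) :
    ∑ i, sigma F (conj i) • D F (conj i) (D F i g) = 0 := by
  have h : ∑ i, sigma F (conj i) • D F (conj i) (D F i g) =
      -∑ i, sigma F (conj i) • D F (conj i) (D F i g) := by
    rw [← Finset.sum_neg_distrib]
    refine Finset.sum_bij (fun i _ => conj i) (fun _ _ => Finset.mem_univ _) ?_ ?_ ?_
    · intro x _ y _ hxy
      rw [← conj_conj x, hxy, conj_conj]
    · intro y _
      exact ⟨conj y, Finset.mem_univ _, conj_conj y⟩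
    · intro x _
      rw [D_comm (conj x) x, sigma_conj (conj x), tau_conj, conj_conj, smul_smul, ← neg_smul]
      congr 1
      have : tau x * tau x = tau x := by
        generalize tau x = y
        clear * -
        decide +revert
      rw [this]
      ring
  have h3 : (2 : F) • ∑ i, sigma F (conj i) • D F (conj i) (D F i g) = 0 := by
    rw [two_smul]
    nth_rewrite 1 [h]
    exact neg_add_cancel _
  exact (smul_eq_zero.1 h3).resolve_left h2

/-- Integration by parts: the bracket is a sum of terms `D_{i'}(f D_i(g))`. -/
theorem DH_eq_sum_D (h2 : (2 : F) ≠ 0) {a : ZMod 2} {f : Lam F (2 * k) (2 * l)}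
    (hf : f ∈ par F a) (g : Lam F (2 * k) (2 * l)) :
    DH F f g = ∑ i, cf F a i • D F (conj i) (mul F f (D F i g)) := by
  rw [DH_apply hf]
  -- The Leibniz rule gives the wanted term plus f times a second-order term. The sign inside `cf`
  -- cancels the Leibniz sign, so the extra terms add up to f times a vanishing sum.
  have h : ∀ i, cf F a i • D F (conj i) (mul F f (D F i g)) =
      cf F a i • mul F (D F (conj i) f) (D F i g) +
      mul F f (sigma F (conj i) • D F (conj i) (D F i g)) := by
    intro i
    rw [D_mul _ hf, smul_add, smul_smul, map_smul, cf, tau_conj, mul_assoc, sgn_mul_self, mul_one]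
  simp only [h, Finset.sum_add_distrib]
  rw [← map_sum, sum_sigma_D_D h2, map_zero, add_zero]

theorem DH_mem_span_proper {p : ℕ} [Fact p.Prime] [CharP F p] (h2 : (2 : F) ≠ 0)
    {t : Fin (2 * k) → ℕ} {a : ZMod 2} {f g : Lam F (2 * k) (2 * l)} (ha : f ∈ par F a)
    (hf : f ∈ truncLam F p l t) (hg : g ∈ truncLam F p l t) :
    DH F f g ∈ Submodule.span F (e F '' properMon p l t) := by
  rw [DH_eq_sum_D h2 ha]
  exact Submodule.sum_mem _ fun i _ => Submodule.smul_mem _ _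
    (D_mem_span_proper _ (mul_mem_trunc hf (D_mem_trunc _ hg)))

theorem e_mem_truncLam {p : ℕ} {t : Fin (2 * k) → ℕ} {a : Mon (2 * k) (2 * l)}
    (ha : a ∈ truncMon p l t) : e F a ∈ truncLam F p l t :=
  Submodule.subset_span ⟨a, ha, rfl⟩

/-- Integration by parts writes every bracket as a sum of derivatives, which have no top component.
-/
theorem H_le_span (p : ℕ) [Fact p.Prime] [CharP F p] (h2 : (2 : F) ≠ 0)
    (t : Fin (2 * k) → ℕ) :
    H F p l t ≤ Submodule.span F ((fun a => DH F (e F a)) '' properMon p l t) := by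
  rw [H_eq]
  refine Submodule.span_le.2 ?_
  rintro _ ⟨_, ⟨a, ha, rfl⟩, _, ⟨b, hb, rfl⟩, rfl⟩
  change sbr F (DH F (e F a)) (DH F (e F b)) ∈ _
  rw [sbr_DH, ← Set.image_image (DH F) (e F), ← Submodule.map_span]
  exact Submodule.mem_map_of_mem
    (DH_mem_span_proper h2 (e_mem_par a) (e_mem_truncLam ha) (e_mem_truncLam hb))

theorem two_lt_pow {p : ℕ} (hp : 2 < p) {r : ℕ} (hr : 1 ≤ r) : 2 < p ^ r :=
  hp.trans_le (Nat.le_self_pow (by omega) p)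

theorem cast_pow_sub_one (p : ℕ) [Fact p.Prime] [CharP F p] {r : ℕ} (hr : 1 ≤ r) :
    ((p ^ r - 1 : ℕ) : F) = -1 := by
  have hp : 1 ≤ p ^ r := Nat.one_le_pow _ _ (Fact.out : p.Prime).pos
  rw [Nat.cast_sub hp, Nat.cast_pow, CharP.cast_eq_zero, zero_pow (by omega)]
  simp

/-- The exponents of `x_a^(2)`. -/
theorem square_mem_proper {p : ℕ} (hp : 2 < p) {t : Fin (2 * k) → ℕ} (ht : ∀ i, 1 ≤ t i)
    (a : Fin (2 * k)) (u : Finset (Fin (2 * l))) : (Pi.single a 2, u) ∈ properMon p l t := by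
  refine proper_of_lt (fun i => ?_) (halfConj a) ?_
  · have := two_lt_pow hp (ht i)
    by_cases h : i = a
    · subst h
      simpa using this
    · simp [h]
      omega
  · have := two_lt_pow hp (ht (halfConj a))
    simp [halfConj_ne]
    omega

theorem mixed_mem_proper {p : ℕ} (hp : 2 < p) {t : Fin (2 * k) → ℕ} (ht : ∀ i, 1 ≤ t i)
    (a : Fin (2 * k)) (u : Finset (Fin (2 * l))) : (Pi.single a 1, u) ∈ properMon p l t := by
  refine proper_of_lt (fun i => ?_) (halfConj a) ?_
  · have := two_lt_pow hp (ht i)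
    by_cases h : i = a
    · subst h
      simp
      omega
    · simp [h]
      omega
  · have := two_lt_pow hp (ht (halfConj a))
    simp [halfConj_ne]
    omega

theorem var_mem_proper {p : ℕ} (hp : 2 < p) (hk : 1 ≤ k) {t : Fin (2 * k) → ℕ}
    (ht : ∀ i, 1 ≤ t i) (i : Fin (2 * k) ⊕ Fin (2 * l)) : var i ∈ properMon p l t := by
  rcases i with i | j
  · exact mixed_mem_proper hp ht i ∅
  · refine proper_of_lt (fun i => ?_) ⟨0, by omega⟩ ?_
    · have := two_lt_pow hp (ht i)
      simp [var]
      omega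
    · have := two_lt_pow hp (ht ⟨0, by omega⟩)
      simp [var]
      omega

theorem single_two_sub (a : Fin (2 * k)) :
    (Pi.single a 2 - Pi.single a 1 : Fin (2 * k) → ℕ) = Pi.single a 1 := by
  ext r
  by_cases h : r = a
  · subst h
    simp
  · simp [h]

theorem D_square (i : Fin (2 * k) ⊕ Fin (2 * l)) (a : Fin (2 * k)) :
    D F i (e F (Pi.single a 2, ∅)) = if i = Sum.inl a then e F (var (Sum.inl a)) else 0 := by
  rw [D_e]
  rcases i with i | j
  · by_cases h : i = a
    · subst h
      simp only [DMon, var, Pi.single_eq_same, if_true]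
      rw [if_neg (by omega), single_two_sub]
    · simp [DMon, h]
  · simp [DMon]

/-- `{x_{a'}^(2), g} = ± x_{a'} D_a(g)`. -/
theorem DH_square (a : Fin (2 * k)) (g : Lam F (2 * k) (2 * l)) :
    DH F (e F (Pi.single (halfConj a) 2, ∅)) g =
      cf F 0 (Sum.inl a : Fin (2 * k) ⊕ Fin (2 * l)) •
        mul F (e F (var (Sum.inl (halfConj a)))) (D F (Sum.inl a) g) := by
  rw [DH_apply (e_mem_par' (b := 0) (by simp [deg])), Finset.sum_eq_single (Sum.inl a)]
  · simp only [conj, Sum.map_inl]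
    rw [D_square, if_pos rfl]
  · intro i _ hi
    rw [D_square, if_neg, map_zero, LinearMap.zero_apply, smul_zero]
    intro h
    refine hi ?_
    rw [← conj_conj i, h]
    simp [conj, halfConj_halfConj]
  · simp

theorem D_inr_mixed (a : Fin (2 * k)) (i j : Fin (2 * l)) :
    D F (Sum.inr i) (e F (Pi.single a 1, {j})) =
      if i = j then e F (var (Sum.inl a)) else 0 := by
  rw [D_e]
  by_cases h : i = j
  · subst h
    simp [DMon, var, Finset.filter_singleton]
  · simp [DMon, h]

/-- Even derivatives leave x_j in both factors, and x_j² = 0. Hence only odd indices contribute to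
the bracket computed in `DH_mixed_univ`. -/
theorem mul_D_inl_univ (i i' : Fin (2 * k)) (j : Fin (2 * l)) (α β : Fin (2 * k) → ℕ) :
    mul F (D F (Sum.inl i) (e F (α, {j}))) (D F (Sum.inl i') (e F (β, Finset.univ))) = 0 := by
  rw [D_e, D_e]
  simp only [DMon]
  split_ifs
  · simp
  · simp
  · simp
  · rw [mul_e_e, mulMon, if_neg]
    simp

/-- `{x_a x_{j'}, x^(β) x_{m+1} ⋯ x_{m+n}} = ± x_a x^(β) ∂_j(x_{m+1} ⋯ x_{m+n})`. -/
theorem DH_mixed_univ (a : Fin (2 * k)) (j : Fin (2 * l)) (β : Fin (2 * k) → ℕ) :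
    DH F (e F (Pi.single a 1, {halfConj j})) (e F (β, Finset.univ)) =
      cf F 1 (Sum.inr j : Fin (2 * k) ⊕ Fin (2 * l)) •
        mul F (e F (var (Sum.inl a))) (D F (Sum.inr j) (e F (β, Finset.univ))) := by
  rw [DH_apply (e_mem_par' (b := 1) (by simp [deg])), Finset.sum_eq_single (Sum.inr j)]
  · simp only [conj, Sum.map_inr]
    rw [D_inr_mixed, if_pos rfl]
  · intro i _ hi
    rcases i with i | i
    · simp only [conj, Sum.map_inl]
      rw [mul_D_inl_univ, smul_zero]
    · simp only [conj, Sum.map_inr]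
      rw [D_inr_mixed, if_neg, map_zero, LinearMap.zero_apply, smul_zero]
      intro h
      refine hi ?_
      rw [← halfConj_halfConj i, h, halfConj_halfConj]
  · simp

/-- The index of the product `x_a x_i`. -/
def varMul (a : Fin (2 * k)) (i : Fin (2 * k) ⊕ Fin (2 * l)) : Mon (2 * k) (2 * l) :=
  ((var i).1 + Pi.single a 1, (var i).2)

theorem D_varMul (a : Fin (2 * k)) (i : Fin (2 * k) ⊕ Fin (2 * l)) :
    D F (Sum.inl a) (e F (varMul a i)) = e F (var i) := by
  rw [D_e, varMul]
  simp only [DMon]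
  rw [if_neg (by simp), add_tsub_cancel_right]

theorem varMul_mem_proper {p : ℕ} (hp : 2 < p) {t : Fin (2 * k) → ℕ} (ht : ∀ i, 1 ≤ t i) (a : Fin (2 * k))
    (i : Fin (2 * k) ⊕ Fin (2 * l)) : varMul a i ∈ properMon p l t := by
  have hpow : ∀ i, 2 < p ^ t i := fun i => two_lt_pow hp (ht i)
  have hle : ∀ b r : Fin (2 * k), (Pi.single b 1 : Fin (2 * k) → ℕ) r ≤ 1 := fun b r => by
    by_cases h : r = b
    · subst h
      simp
    · simp [h]
  have hv : ∀ r, (var i).1 r ≤ 1 := fun r => by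
    rcases i with i | j
    · exact hle i r
    · exact Nat.zero_le _
  refine proper_of_lt (fun r => ?_) (halfConj a) ?_
  · have h1 := hle a r
    have h2 := hv r
    have h3 := hpow r
    simp only [varMul, Pi.add_apply]
    omega
  · have h2 := hv (halfConj a)
    have h3 := hpow (halfConj a)
    simp only [varMul, Pi.add_apply]
    rw [Pi.single_eq_of_ne (halfConj_ne a)]
    omega

/-- A subspace that contains all brackets with the `D_H(x_i)`, and all brackets with those
`D_H(x^(α) x^u)` that it contains, contains all `D_H(x^(α) x^u)` except for the top one. -/
theorem DH_mem_of_closed {p : ℕ} [Fact p.Prime] [CharP F p] (hp : 2 < p) (hk : 1 ≤ k)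
    (hl : 1 ≤ l) {t : Fin (2 * k) → ℕ} (ht : ∀ i, 1 ≤ t i)
    {K : Submodule F (Module.End F (Lam F (2 * k) (2 * l)))}
    (h1 : ∀ i, ∀ c ∈ properMon p l t, sbr F (DH F (e F (var i))) (DH F (e F c)) ∈ K)
    (h2 : ∀ q ∈ properMon p l t, ∀ c ∈ properMon p l t, DH F (e F q) ∈ K →
      sbr F (DH F (e F q)) (DH F (e F c)) ∈ K)
    {c : Mon (2 * k) (2 * l)} (hc : c ∈ properMon p l t) : DH F (e F c) ∈ K := by
  -- Bracketing with x_{i'} is a nonzero multiple of D_i. So a monomial is reached whenever raising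
  -- it by one variable stays below the top; the two `htop` cases below treat the monomials for
  -- which the chosen raise is the top.
  have hD : ∀ i, ∀ c ∈ properMon p l t, DH F (D F i (e F c)) ∈ K := by
    intro i c hc
    have := h1 (conj i) c hc
    rw [sbr_DH, DH_var, conj_conj, map_smul] at this
    exact (Submodule.smul_mem_iff _ (cf_ne_zero _ _)).1 this
  have hpow : ∀ i, 2 < p ^ t i := fun i => two_lt_pow hp (ht i)
  have hpF : ∀ i, ((p ^ t i - 1 : ℕ) : F) = -1 := fun i => cast_pow_sub_one p (ht i)
  obtain ⟨α, u⟩ := c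
  obtain ⟨hc, hne⟩ := hc
  have hcα : ∀ i, α i < p ^ t i := hc
  by_cases hu : u = Finset.univ
  · subst hu
    have hα : α ≠ fun i => p ^ t i - 1 := fun h => hne (by rw [h])
    obtain ⟨i, hi⟩ := Function.ne_iff.1 hα
    have hs : α + Pi.single i 1 - Pi.single i 1 = α := add_tsub_cancel_right _ _
    have hDe : D F (Sum.inl i) (e F (α + Pi.single i 1, Finset.univ)) =
        e F ((α, Finset.univ) : Mon (2 * k) (2 * l)) := by
      rw [D_e]
      simp only [DMon]
      rw [if_neg (by simp), hs]
    by_cases htop : (α + Pi.single i 1 : Fin (2 * k) → ℕ) = fun i => p ^ t i - 1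
    -- Here x^(α) is one step below the top in direction i, so its exponent at i' ≠ i is maximal.
    -- The bracket of x_{i'}^(2) with the monomial one step below the top in direction i' trades one
    -- x_i for one x_{i'}.
    · have hαi : α (halfConj i) = p ^ t (halfConj i) - 1 := by
        rw [← congrFun htop (halfConj i)]
        simp [halfConj_ne]
      -- x_{i'}^(2) is itself a derivative, of x_{i'}^(2) times an odd variable; that product is
      -- proper because its exponent at i is 0.
      have hq : DH F (e F (Pi.single (halfConj i) 2, (∅ : Finset (Fin (2 * l))))) ∈ K := by
        have := hD (Sum.inr ⟨0, by omega⟩) _ (square_mem_proper (l := l) hp ht (halfConj i)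
          {⟨0, by omega⟩})
        rw [D_e] at this
        simpa [DMon, Finset.filter_singleton] using this
      have h3 := h2 _ (square_mem_proper hp ht _ _)
        (α + Pi.single i 1 - Pi.single (halfConj i) 1, Finset.univ) (proper_of_lt (fun r => ?_)
        (halfConj i) ?_) hq
      · have h4 : (α + Pi.single i 1 - Pi.single (halfConj i) 1 : Fin (2 * k) → ℕ) -
            Pi.single i 1 = α - Pi.single (halfConj i) 1 := by
          rw [tsub_right_comm, hs]
        rw [sbr_DH, DH_square, D_e] at h3
        simp only [DMon] at h3
        rw [if_neg (by simp [(halfConj_ne i).symm]), h4, mul_var_inl (by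
          rw [hαi]
          have := hpow (halfConj i)
          omega), hαi, hpF, smul_smul, map_smul] at h3
        exact (Submodule.smul_mem_iff _ (mul_ne_zero (cf_ne_zero _ _) (by simp))).1 h3
      · rw [htop]
        have := hpow r
        simp only [Pi.sub_apply]
        omega
      · rw [htop]
        have := hpow (halfConj i)
        simp only [Pi.sub_apply, Pi.single_eq_same]
        omega
    · rw [← hDe]
      refine hD _ _ ⟨fun r => ?_, fun h => htop (Prod.mk.inj h).1⟩
      have h3 := hcα r
      simp only [Pi.add_apply]
      by_cases hr : r = i
      · subst hr
        simp only [Pi.single_eq_same]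
        omega
      · simpa [hr] using h3
  · obtain ⟨j, hj⟩ : ∃ j, j ∉ u := by
      by_contra h
      push Not at h
      exact hu (Finset.eq_univ_iff_forall.2 h)
    have hDe : ∀ β, D F (Sum.inr j) (e F (β, insert j u)) =
        (-1 : F) ^ ((insert j u).filter (· < j)).card •
          e F ((β, u) : Mon (2 * k) (2 * l)) := by
      intro β
      rw [D_e]
      simp only [DMon]
      rw [if_pos (Finset.mem_insert_self _ _), Finset.erase_insert hj]
    have hs : (-1 : F) ^ ((insert j u).filter (· < j)).card ≠ 0 := pow_ne_zero _ (by simp)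
    by_cases htop : ((α, insert j u) : Mon (2 * k) (2 * l)) =
        (fun i => p ^ t i - 1, Finset.univ)
    · obtain ⟨hα, hju⟩ := Prod.mk.inj htop
      -- Only x_j is missing from the top. Any even index a works: the bracket of x_a x_{j'} with
      -- the monomial one step below the top in direction a deletes x_j and restores x_a, with
      -- coefficient ±(p^(t_a) - 1) = ∓1. The element x_a x_{j'} is the a-th derivative of x_a^(2)
      -- x_{j'}.
      have a : Fin (2 * k) := ⟨0, by omega⟩
      have hαa : α a = p ^ t a - 1 := congrFun hα a
      have hq : DH F (e F (Pi.single a 1, {halfConj j})) ∈ K := by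
        have := hD (Sum.inl a) _ (square_mem_proper (l := l) hp ht a {halfConj j})
        rw [D_e] at this
        simp only [DMon] at this
        rw [if_neg (by simp), single_two_sub] at this
        exact this
      have h3 := h2 _ (mixed_mem_proper hp ht _ _)
        (α - Pi.single a 1, Finset.univ) (proper_of_lt (fun r => ?_) a ?_) hq
      · rw [sbr_DH, DH_mixed_univ, ← hju, hDe, map_smul, map_smul, mul_var_inl (by
          rw [hαa]
          have := hpow a
          omega), hαa, hpF, smul_smul, map_smul, smul_smul] at h3
        exact (Submodule.smul_mem_iff _
          (mul_ne_zero (cf_ne_zero _ _) (mul_ne_zero hs (by simp)))).1 h3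
      · exact lt_of_le_of_lt (Nat.sub_le _ _) (hcα r)
      · have := hpow a
        simp only [Pi.sub_apply, Pi.single_eq_same, hαa]
        omega
    · have h3 := hD (Sum.inr j) (α, insert j u) ⟨hc, htop⟩
      rw [hDe, map_smul] at h3
      exact (Submodule.smul_mem_iff _ hs).1 h3

end

end Ham

namespace Ham

/-! ### Perfectness, center and centroid of H -/

section

variable {F : Type*} [Field F] {k l : ℕ} {p : ℕ} [Fact p.Prime] [CharP F p]
  {t : Fin (2 * k) → ℕ}

/-- The generation statement with K = H. With `H_le_span` it identifies H as the span of D_H of the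
non-top monomials. -/
theorem DH_mem_H (hp : 2 < p) (hk : 1 ≤ k) (hl : 1 ≤ l) (ht : ∀ i, 1 ≤ t i)
    {c : Mon (2 * k) (2 * l)} (hc : c ∈ properMon p l t) : DH F (e F c) ∈ H F p l t := by
  have hb : ∀ c ∈ properMon p l t, DH F (e F c) ∈ HBar F p l t := fun c hc =>
    Submodule.mem_map_of_mem (e_mem_truncLam hc.1)
  exact DH_mem_of_closed hp hk hl ht
    (fun i c hc => Submodule.apply_mem_map₂ _ (hb _ (var_mem_proper hp hk ht i)) (hb c hc))
    (fun q hq c hc _ => Submodule.apply_mem_map₂ _ (hb q hq) (hb c hc)) hc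

theorem H_le_of_closed (hp : 2 < p) (hk : 1 ≤ k) (hl : 1 ≤ l) (ht : ∀ i, 1 ≤ t i)
    {K : Submodule F (Module.End F (Lam F (2 * k) (2 * l)))}
    (h1 : ∀ i, ∀ c ∈ properMon p l t, sbr F (DH F (e F (var i))) (DH F (e F c)) ∈ K)
    (h2 : ∀ q ∈ properMon p l t, ∀ c ∈ properMon p l t, DH F (e F q) ∈ K →
      sbr F (DH F (e F q)) (DH F (e F c)) ∈ K) : H F p l t ≤ K := by
  have h20 : (2 : F) ≠ 0 := Ring.two_ne_zero (by
    rw [ringChar.eq F p]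
    omega)
  refine (H_le_span p h20 t).trans (Submodule.span_le.2 ?_)
  rintro _ ⟨c, hc, rfl⟩
  exact DH_mem_of_closed hp hk hl ht h1 h2 hc

/-- The generation statement is applied to the span of the brackets of H: the variables and the
non-top monomials already lie in H, so every bracket it requires is a bracket of elements of H. -/
theorem H_isPerfect (hp : 2 < p) (hk : 1 ≤ k) (hl : 1 ≤ l) (ht : ∀ i, 1 ≤ t i) :
    LieSuperalgebra.IsPerfect F (H F p l t) := by
  have hH := fun (c : Mon (2 * k) (2 * l)) (hc : c ∈ properMon p l t) =>
    DH_mem_H (F := F) hp hk hl ht hc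
  have key : ∀ q ∈ properMon p l t, ∀ c ∈ properMon p l t,
      sbr F (DH F (e F q)) (DH F (e F c)) ∈ (Submodule.span F (Set.range
        fun q : H F p l t × H F p l t =>
          LieSuperalgebra.bracket (F := F) q.1 q.2)).map (H F p l t).subtype := fun q hq c hc =>
    ⟨_, Submodule.subset_span ⟨(⟨_, hH q hq⟩, ⟨_, hH c hc⟩), rfl⟩, rfl⟩
  refine eq_top_iff.2 fun x _ => ?_
  obtain ⟨y, hy, hyx⟩ := H_le_of_closed hp hk hl ht
    (fun i c hc => key _ (var_mem_proper hp hk ht i) c hc) (fun q hq c hc _ => key q hq c hc) x.2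
  rwa [← Subtype.ext hyx]

/-- If all `{x_i, f}` are constants, then so are the `D_i(f)`. -/
theorem exists_D_const {f : Lam F (2 * k) (2 * l)}
    (h : ∀ i, sbr F (DH F (e F (var i))) (DH F f) = 0) :
    ∃ c : Fin (2 * k) ⊕ Fin (2 * l) → F, ∀ i, D F i f = c i • e F (0, ∅) := by
  refine Classical.skolem.1 fun i => exists_const_of_D fun j => ?_
  have h1 := h (conj i)
  rw [sbr_DH, DH_var, conj_conj, map_smul] at h1
  exact D_eq_zero_of_DH ((smul_eq_zero.1 h1).resolve_left (cf_ne_zero _ _)) j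

theorem DH_var_ne_zero (i : Fin (2 * k) ⊕ Fin (2 * l)) : DH F (e F (var i)) ≠ 0 := fun h => by
  have := D_eq_zero_of_DH h i
  rw [D_var, if_pos rfl] at this
  exact e_ne_zero _ this

theorem H_isCenterless (hp : 2 < p) (hk : 1 ≤ k) (hl : 1 ≤ l) (ht : ∀ i, 1 ≤ t i) :
    LieSuperalgebra.IsCenterless F (H F p l t) := by
  refine LieSuperalgebra.isCenterless_of_right fun z hz => ?_
  obtain ⟨f, -, hf⟩ := H_le p l t z.2
  have hz' : ∀ c ∈ properMon p l t, sbr F (DH F (e F c)) (DH F f) = 0 := fun c hc => by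
    rw [hf]
    exact congrArg Subtype.val (hz ⟨_, DH_mem_H hp hk hl ht hc⟩)
  obtain ⟨c, hc⟩ := exists_D_const fun i => hz' _ (var_mem_proper hp hk ht i)
  -- Here {x_{a'}^(2), f} is a nonzero multiple of c_a x_{a'}, and D_H(x_{a'}) ≠ 0.
  have h1 : ∀ a, c (Sum.inl a) = 0 := by
    intro a
    have h := hz' _ (square_mem_proper hp ht (halfConj a) ∅)
    rw [sbr_DH, DH_square, hc, map_smul, map_smul, mul_one', map_smul] at h
    exact (smul_eq_zero.1 ((smul_eq_zero.1 h).resolve_left (cf_ne_zero _ _))).resolve_right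
      (DH_var_ne_zero _)
  -- The even constants being zero, {x_a x_{j'}, f} reduces to a nonzero multiple of c_j x_a.
  have h2 : ∀ j, c (Sum.inr j) = 0 := by
    intro j
    have a : Fin (2 * k) := ⟨0, by omega⟩
    have h := hz' _ (mixed_mem_proper hp ht a {halfConj j})
    rw [sbr_DH, DH_of_D_const (e_mem_par' (b := 1) (by simp [deg])) hc,
      Finset.sum_eq_single (Sum.inr j)] at h
    · simp only [conj, Sum.map_inr] at h
      rw [D_inr_mixed, if_pos rfl, map_smul] at h
      exact (mul_eq_zero.1 ((smul_eq_zero.1 h).resolve_right (DH_var_ne_zero _))).resolve_left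
        (cf_ne_zero _ _)
    · intro i _ hi
      rcases i with i | i
      · rw [h1, mul_zero, zero_smul]
      · simp only [conj, Sum.map_inr]
        rw [D_inr_mixed, if_neg, smul_zero]
        intro h
        refine hi ?_
        rw [← halfConj_halfConj i, h, halfConj_halfConj]
    · simp
  refine Subtype.ext (hf.symm.trans (DH_eq_zero_of_D fun i => ?_))
  rw [hc]
  rcases i with a | j
  · rw [h1, zero_smul]
  · rw [h2, zero_smul]

/-- The centroid of `H` consists of scalars. -/
theorem H_centroid (hp : 2 < p) (hk : 1 ≤ k) (hl : 1 ≤ l) (ht : ∀ i, 1 ≤ t i) (g : ZMod 2)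
    (γ : H F p l t →ₗ[F] H F p l t)
    (hγ : ∀ {a : ZMod 2} {x : H F p l t}, x ∈ LieSuperalgebra.part (F := F) a →
      γ x ∈ LieSuperalgebra.part (F := F) (a + g))
    (hγl : ∀ x y, γ (LieSuperalgebra.bracket (F := F) x y) =
      LieSuperalgebra.bracket (F := F) (γ x) y)
    (hγr : ∀ {a : ZMod 2} {x : H F p l t} (y : H F p l t),
      x ∈ LieSuperalgebra.part (F := F) a → γ (LieSuperalgebra.bracket (F := F) x y) =
        sgn F (g * a) • LieSuperalgebra.bracket (F := F) x (γ y)) :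
    ∃ c : F, (g = 1 → c = 0) ∧ ∀ x, γ x = c • x := by
  have hH := fun (c : Mon (2 * k) (2 * l)) (hc : c ∈ properMon p l t) =>
    DH_mem_H (F := F) hp hk hl ht hc
  have hvar := fun i => var_mem_proper (l := l) hp hk ht i
  let X : Fin (2 * k) ⊕ Fin (2 * l) → H F p l t := fun i => ⟨_, hH _ (hvar i)⟩
  have hXp : ∀ i, X i ∈ LieSuperalgebra.part (F := F) (tau i) := fun i =>
    DH_mem (var_mem_par i)
  have a : Fin (2 * k) := ⟨0, by omega⟩
  obtain ⟨v, -, hv⟩ := H_le p l t (γ (X (Sum.inl a))).2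
  -- Brackets of variables are constants, which D_H kills. Applying γ shows that γ(x_a) also
  -- commutes with all variables, so its potential v has constant derivatives.
  have hX0 : ∀ i, LieSuperalgebra.bracket (F := F) (X i) (X (Sum.inl a)) = 0 := by
    intro i
    refine Subtype.ext ?_
    change sbr F (DH F (e F (var i))) (DH F (e F (var (Sum.inl a)))) = 0
    rw [sbr_DH, DH_var, D_var]
    split_ifs
    · rw [map_smul, DH_one, smul_zero]
    · rw [smul_zero, map_zero]
  obtain ⟨c, hc⟩ := exists_D_const (f := v) fun i => by
    have h1 := hγr (X (Sum.inl a)) (hXp i)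
    rw [hX0, map_zero] at h1
    have h2 := congrArg Subtype.val ((smul_eq_zero.1 h1.symm).resolve_left (sgn_ne_zero _))
    rw [hv]
    exact h2
  -- The candidate scalar is D_a(v). Bracketing with x_{a'}^(2) sees only D_a, so other derivatives
  -- of v play no role, and it gives γ(x_{a'}) = c₀ x_{a'}.
  let c₀ := c (Sum.inl a)
  let Q : H F p l t := ⟨_, hH _ (square_mem_proper hp ht (halfConj a) ∅)⟩
  have hQp : Q ∈ LieSuperalgebra.part (F := F) 0 :=
    DH_mem (e_mem_par' (b := 0) (by simp [deg]))
  have hQX : LieSuperalgebra.bracket (F := F) Q (X (Sum.inl a)) =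
      cf F 0 (Sum.inl a : Fin (2 * k) ⊕ Fin (2 * l)) • X (Sum.inl (halfConj a)) := by
    refine Subtype.ext ?_
    change sbr F (DH F (e F _)) (DH F (e F (var (Sum.inl a)))) = _ • DH F _
    rw [sbr_DH, DH_square, D_var, if_pos rfl, mul_one', map_smul]
  have hQγ : LieSuperalgebra.bracket (F := F) Q (γ (X (Sum.inl a))) =
      cf F 0 (Sum.inl a : Fin (2 * k) ⊕ Fin (2 * l)) • c₀ • X (Sum.inl (halfConj a)) := by
    refine Subtype.ext ?_
    change sbr F (DH F (e F _)) (γ (X (Sum.inl a))).1 = _ • c₀ • DH F _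
    rw [← hv, sbr_DH, DH_square, hc, map_smul, map_smul, mul_one', map_smul]
  have h0 : γ (X (Sum.inl (halfConj a))) = c₀ • X (Sum.inl (halfConj a)) := by
    have h1 := hγr (X (Sum.inl a)) hQp
    rw [hQX, hQγ, mul_zero, sgn_zero, one_smul, map_smul] at h1
    exact smul_right_injective _ (cf_ne_zero _ _) h1
  -- For odd γ the element c₀ x_{a'} would be both even and odd.
  have hg : g = 1 → c₀ = 0 := by
    rintro rfl
    have h1 := hγ (hXp (Sum.inl (halfConj a)))
    rw [h0, tau_inl, zero_add] at h1
    have h2 : c₀ • X (Sum.inl (halfConj a)) ∈ LieSuperalgebra.part (F := F) 0 :=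
      Submodule.smul_mem _ _ (hXp (Sum.inl (halfConj a)))
    have h3 : c₀ • DH F (e F (var (Sum.inl (halfConj a)))) =
        (0 : Module.End F (Lam F (2 * k) (2 * l))) := end_disjoint h2 h1
    exact (smul_eq_zero.1 h3).resolve_right (DH_var_ne_zero _)
  have hsg : ∀ b, sgn F (g * b) * c₀ = c₀ := fun b => by
    rcases zmod2_cases g with h | h
    · rw [h, zero_mul, sgn_zero, one_mul]
    · rw [hg h, mul_zero]
  have hX : ∀ i, γ (X i) = c₀ • X i := by
    intro i
    -- The bracket of the quadratic element R with x_{a'} is a nonzero multiple of D_a(R) = x_i,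
    -- which transports the scalar from x_{a'} to every variable.
    let R : H F p l t := ⟨_, hH _ (varMul_mem_proper hp ht a i)⟩
    have hRp : R ∈ LieSuperalgebra.part (F := F) (deg (varMul a i)) := DH_mem (e_mem_par _)
    have h1 := hγr (X (Sum.inl (halfConj a))) hRp
    have h2 : LieSuperalgebra.bracket (F := F) R (X (Sum.inl (halfConj a))) =
        cf F (deg (varMul a i)) (Sum.inl (halfConj a) : Fin (2 * k) ⊕ Fin (2 * l)) • X i := by
      refine Subtype.ext ?_
      change sbr F (DH F (e F _)) (DH F (e F _)) = _ • DH F _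
      rw [sbr_DH, DH_apply_var (e_mem_par _)]
      simp only [conj, Sum.map_inl]
      rw [halfConj_halfConj, D_varMul, map_smul]
    rw [h0, map_smul, smul_smul, hsg, h2, map_smul, smul_comm] at h1
    exact smul_right_injective _ (cf_ne_zero _ _) h1
  refine ⟨c₀, hg, fun x => ?_⟩
  -- δ([x,y]) = [δ(x),y], so ker δ contains [x,y] as soon as it contains x. It contains the
  -- variables, and the generation statement makes it all of H.
  let δ : H F p l t →ₗ[F] H F p l t := γ - c₀ • LinearMap.id
  have hδ : ∀ x y, δ (LieSuperalgebra.bracket (F := F) x y) =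
      LieSuperalgebra.bracket (F := F) (δ x) y := fun x y => by
    simp only [δ, LinearMap.sub_apply, LinearMap.smul_apply, LinearMap.id_apply, map_sub,
      map_smul, hγl]
  obtain ⟨y, hy, hyx⟩ := H_le_of_closed (K := (LinearMap.ker δ).map (H F p l t).subtype)
    hp hk hl ht (fun i c hc => ⟨LieSuperalgebra.bracket (F := F) (X i) ⟨_, hH c hc⟩, by
      have h1 : δ (X i) = 0 := by
        simp only [δ, LinearMap.sub_apply, LinearMap.smul_apply, LinearMap.id_apply, hX, sub_self]
      rw [SetLike.mem_coe, LinearMap.mem_ker, hδ, h1, map_zero, LinearMap.zero_apply], rfl⟩)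
    (fun q hq c hc ⟨z, hz, hzq⟩ => ⟨LieSuperalgebra.bracket (F := F) z ⟨_, hH c hc⟩, by
      rw [SetLike.mem_coe, LinearMap.mem_ker, hδ, LinearMap.mem_ker.1 hz, map_zero,
        LinearMap.zero_apply], by rw [← hzq]; rfl⟩) x.2
  rw [← Subtype.ext hyx]
  exact sub_eq_zero.1 hy

end

end Ham

theorem mainTheorem1 (F : Type*) [Field F] [IsAlgClosed F] (p : ℕ) [Fact p.Prime] [CharP F p]
    (hp : 2 < p) (k l : ℕ) (hk : 1 ≤ k) (hl : 1 ≤ l) (t : Fin (2 * k) → ℕ)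
    (ht : ∀ i, 1 ≤ t i) :
    LieSuperalgebra.BDer F (Ham.H F p l t) = LieSuperalgebra.IBDer F (Ham.H F p l t) :=
  LieSuperalgebra.BDer_eq_IBDer (Ring.two_ne_zero (by rw [ringChar.eq F p]; omega))
    (Ham.H_isPerfect hp hk hl ht) (Ham.H_isCenterless hp hk hl ht)
    (Ham.H_centroid hp hk hl ht)
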